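/- Let $r\ge 1$, let $\mathcal U$ be a set, and for every $n\in\mathbb N$ let $[n]=\{1,\dots,n\}$ be partitioned into intervals $N_1,\dots,N_r$ (depending on $n$), all nonempty for all sufficiently large $n$, such that $n_q/n\to d_q$ as $n\to\infty$ for every $q\in[r]$, where $n_q=|N_q|$ (the values $d_q=0$ are allowed). For each $u\in\mathcal U$ let $V(u)=(v_{p,q}(u))$ be a symmetric $r\times r$ matrix with positive entries. Let $\{Y(u,n):u\in\mathcal U,\,n\in\mathbb N\}$ be a family of independent Hermitian Gaussian random matrices on a probability space, that is, for each $n$ the $Y(u,n)$ are $n\times n$ Hermitian random matrices such that the variables $\{\mathrm{Re}\,Y_{i,j}(u,n),\ \mathrm{Im}\,Y_{i,j}(u,n): 1\le i\le j\le n,\ u\in\mathcal U\}$ are independent Gaussian with mean zero, and $$\mathbb E\,|Y_{j,j}(u,n)|^2=\frac{v_{q,q}(u)}{n}\quad (j\in N_q),\qquad \mathbb E\,(\mathrm{Re}\,Y_{i,j}(u,n))^2=\mathbb E\,(\mathrm{Im}\,Y_{i,j}(u,n))^2=\frac{v_{p,q}(u)}{2n}\quad (i\in N_p,\ j\in N_q,\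 i\ne j).$$ Let $D_q$ be the diagonal $n\times n$ matrix with $(D_q)_{j,j}=1$ if $j\in N_q$ and $(D_q)_{j,j}=0$ otherwise, let $T_{q,q}(u,n)=D_qY(u,n)D_q$ and $T_{p,q}(u,n)=D_pY(u,n)D_q+D_qY(u,n)D_p$ for $p\neq q$ be the symmetric blocks, and let $\tau_q(n)(X)=\mathbb E\big(\frac1{n_q}\sum_{j\in N_q}X_{j,j}\big)$ be the partial traces. Let $\mathcal M$ be the Hilbert space with orthonormal basis consisting of the vacuum vectors $\Omega_1,\dots,\Omega_r$ and of the simple tensors $e_{p_1,p_2}(u_1)\otimes e_{p_2,p_3}(u_2)\otimes\cdots\otimes e_{p_m,q}(u_m)$ with $m\ge1$, $p_1,\dots,p_m,q\in[r]$, $u_1,\dots,u_m\in\mathcal U$ (the matricially free Fock space of tracial type), and let $\Psi_q(a)=\langle a\Omega_q,\Omega_q\rangle$. Put $b_{p,q}(u)=d_p\,v_{p,q}(u)$. Let $\wp_{p,q}(u)$ be the bounded operator on $\mathcal M$ with $\wp_{p,q}(u)\Omega_q=\sqrt{b_{p,q}(u)}\,e_{p,q}(u)$, $\wp_{p,q}(u)(e_{q,s}(t)\otimes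 w)=\sqrt{b_{p,q}(u)}\,e_{p,q}(u)\otimes e_{q,s}(t)\otimes w$ for each basis vector $e_{q,s}(t)\otimes w$ whose first matricial index is $q$ ($w$ may be absent), and $\wp_{p,q}(u)=0$ on the remaining basis vectors. Let $\widehat\wp_{q,q}(u)=\wp_{q,q}(u)$, $\widehat\wp_{p,q}(u)=\wp_{p,q}(u)+\wp_{q,p}(u)$ for $p\ne q$, and let $\widehat\omega_{p,q}(u)=\widehat\wp_{p,q}(u)+\widehat\wp_{p,q}(u)^*$ be the symmetrized Gaussian operators. Then for all $m\ge 0$, $u_1,\dots,u_m\in\mathcal U$ and $p_1,q_1,\dots,p_m,q_m,q\in[r]$, the entries of $T_{p_1,q_1}(u_1,n)\cdots T_{p_m,q_m}(u_m,n)$ are integrable for every $n$, and $$\lim_{n\to\infty}\tau_q(n)\big(T_{p_1,q_1}(u_1,n)\cdots T_{p_m,q_m}(u_m,n)\big)=\Psi_q\big(\widehat\omega_{p_1,q_1}(u_1)\cdots\widehat\omega_{p_m,q_m}(u_m)\big).$$ -/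

import Mathlib

open MeasureTheory ProbabilityTheory Filter Topology

namespace BlockGauss

/-! ## Random matrices with a block structure -/

/-- `N 0, …, N (r-1)` are pairwise disjoint (possibly empty) intervals whose union is `Fin n`. -/
structure IsIntervalPartition {n r : ℕ} (N : Fin r → Finset (Fin n)) : Prop where
  interval : ∀ q, (N q : Set (Fin n)).OrdConnected
  disjoint : ∀ p q, p ≠ q → Disjoint (N p) (N q)
  cover : ∀ j, ∃ q, j ∈ N q

/-- The diagonal `0/1` matrix `D_q` which selects the coordinates in the block `N q`. -/
def blockProj {n r : ℕ} (N : Fin r → Finset (Fin n)) (q : Fin r) : Matrix (Fin n) (Fin n) ℂ :=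
  Matrix.diagonal fun j => if j ∈ N q then 1 else 0

/-- The symmetric block `T_{p,q}` of the matrix `Y`. -/
def symBlock {n r : ℕ} (N : Fin r → Finset (Fin n)) (Y : Matrix (Fin n) (Fin n) ℂ)
    (p q : Fin r) : Matrix (Fin n) (Fin n) ℂ :=
  if p = q then blockProj N q * Y * blockProj N q
  else blockProj N p * Y * blockProj N q + blockProj N q * Y * blockProj N p

/-- The trace over the basis vectors indexed by the block `N q`, divided by the size of `N q`. -/
noncomputable def partialTr {n r : ℕ} (N : Fin r → Finset (Fin n)) (q : Fin r)
    (X : Matrix (Fin n) (Fin n) ℂ) : ℂ :=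
  (∑ j ∈ N q, X j j) / ((N q).card : ℂ)

/-- The partial trace `τ_q`: expectation composed with `partialTr`. -/
noncomputable def tauPartial {S : Type*} [MeasurableSpace S] (μ : Measure S) {n r : ℕ}
    (N : Fin r → Finset (Fin n)) (q : Fin r) (X : S → Matrix (Fin n) (Fin n) ℂ) : ℂ :=
  ∫ x, partialTr N q (X x) ∂μ

/-- The real part (`false`) or the imaginary part (`true`) of a complex number. -/
def reOrIm : Bool → ℂ → ℝ
  | false, z => z.re
  | true, z => z.im

/-- A Hermitian Gaussian random matrix of size `n` whose entries have block variances `V p q / n`: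
the real and imaginary parts of the entries on and above the diagonal are independent centered
Gaussian variables. (The imaginary part of a diagonal entry is almost surely zero, because the
matrix is Hermitian.) -/
structure IsHGRM {S : Type*} [MeasurableSpace S] (μ : Measure S) {n r : ℕ}
    (N : Fin r → Finset (Fin n)) (V : Matrix (Fin r) (Fin r) ℝ)
    (Y : S → Matrix (Fin n) (Fin n) ℂ) : Prop where
  hermitian : ∀ᵐ x ∂μ, (Y x).IsHermitian
  indep : iIndepFun (fun (k : {ij : Fin n × Fin n // ij.1 ≤ ij.2} × Bool) (x : S) =>
    reOrIm k.2 (Y x k.1.1.1 k.1.1.2)) μ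
  law_diag : ∀ q, ∀ j ∈ N q,
    HasLaw (fun x => (Y x j j).re) (gaussianReal 0 (V q q / n).toNNReal) μ
  law_re : ∀ p q, ∀ i ∈ N p, ∀ j ∈ N q, i ≠ j →
    HasLaw (fun x => (Y x i j).re) (gaussianReal 0 (V p q / (2 * n)).toNNReal) μ
  law_im : ∀ p q, ∀ i ∈ N p, ∀ j ∈ N q, i ≠ j →
    HasLaw (fun x => (Y x i j).im) (gaussianReal 0 (V p q / (2 * n)).toNNReal) μ

/-- An independent family of Hermitian Gaussian random matrices of size `n`, with block variance
matrices `V u`. -/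
structure IsIndepHGRM {S : Type*} [MeasurableSpace S] (μ : Measure S) {n r : ℕ} {U : Type*}
    (N : Fin r → Finset (Fin n)) (V : U → Matrix (Fin r) (Fin r) ℝ)
    (Y : U → S → Matrix (Fin n) (Fin n) ℂ) : Prop where
  hgrm : ∀ u, IsHGRM μ N (V u) (Y u)
  indep : iIndepFun (fun (k : U × {ij : Fin n × Fin n // ij.1 ≤ ij.2} × Bool) (x : S) =>
    reOrIm k.2.2 (Y k.1 x k.2.1.1.1 k.2.1.1.2)) μ

/-! ## The matricially free Fock space of tracial type -/

/-- Labels of the canonical orthonormal basis of the Fock space in the case of one-dimensional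
spaces `ℂ e_{p,q}(u)`. The label `([(p₁, u₁), …, (pₘ, uₘ)], q)` stands for the simple tensor
`e_{p₁,p₂}(u₁) ⊗ e_{p₂,p₃}(u₂) ⊗ ⋯ ⊗ e_{pₘ,q}(uₘ)`, and `([], q)` for the vacuum vector `Ω_q`. -/
abbrev Label (r : ℕ) (U : Type*) : Type _ := List (Fin r × U) × Fin r

/-- The first matricial index of a basis vector: `q` for `Ω_q`, and `p₁` for
`e_{p₁,p₂}(u₁) ⊗ ⋯ ⊗ e_{pₘ,q}(uₘ)`. -/
def Label.first {r : ℕ} {U : Type*} : Label r U → Fin r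
  | ([], q) => q
  | (a :: _, _) => a.1

/-- The label of `e_{p,s}(u) ⊗ w`, where `s` is the first matricial index of `w`
(of `e_{p,s}(u)` if `w` is the vacuum `Ω_s`). -/
def Label.tens {r : ℕ} {U : Type*} (p : Fin r) (u : U) (w : Label r U) : Label r U :=
  ((p, u) :: w.1, w.2)

/-- The matricially free Fock space of tracial type: the Hilbert space with the orthonormal basis
indexed by `Label r U`. -/
abbrev Fock (r : ℕ) (U : Type*) : Type _ := lp (fun _ : Label r U => ℂ) 2

open Classical in
/-- The canonical basis vector with label `w`. -/
noncomputable def basisVec {r : ℕ} {U : Type*} (w : Label r U) : Fock r U :=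
  lp.single 2 w (1 : ℂ)

/-- The vacuum vector `Ω_q`. -/
noncomputable def vacuum {r : ℕ} (U : Type*) (q : Fin r) : Fock r U := basisVec ([], q)

/-- The vacuum state `Ψ_q(a) = ⟨a Ω_q, Ω_q⟩` (Mathlib's inner product is linear in the second
argument). -/
noncomputable def vacState {r : ℕ} {U : Type*} (q : Fin r) (a : Fock r U →L[ℂ] Fock r U) : ℂ :=
  inner ℂ (vacuum U q) (a (vacuum U q))

open Classical in
/-- Coordinates of the image under the creation operator. -/
noncomputable def creationFun {r : ℕ} {U : Type*} (β : ℝ) (p q : Fin r) (u : U)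
    (f : Label r U → ℂ) : Label r U → ℂ
  | ([], _) => 0
  | (a :: l, s) => if a = (p, u) ∧ Label.first (l, s) = q then (Real.sqrt β : ℂ) * f (l, s) else 0

theorem tens_injective {r : ℕ} {U : Type*} (p : Fin r) (u : U) :
    Function.Injective (Label.tens p u : Label r U → Label r U) := by
  rintro ⟨l, s⟩ ⟨l', s'⟩ h
  simp only [Label.tens, Prod.mk.injEq, List.cons.injEq, true_and] at h
  exact Prod.ext h.1 h.2

theorem creationFun_of_notMem {r : ℕ} {U : Type*} (β : ℝ) (p q : Fin r) (u : U)
    (f : Label r U → ℂ) (w : Label r U) (hw : w ∉ Set.range (Label.tens p u)) :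
    creationFun β p q u f w = 0 := by
  rcases w with ⟨_ | ⟨a, l⟩, s⟩
  · rfl
  · have : a ≠ (p, u) := by
      rintro rfl
      exact hw ⟨(l, s), rfl⟩
    simp [creationFun, this]

theorem norm_creationFun_tens_le {r : ℕ} {U : Type*} (β : ℝ) (p q : Fin r) (u : U)
    (f : Label r U → ℂ) (w : Label r U) :
    ‖creationFun β p q u f (Label.tens p u w)‖ ^ (2 : ℝ) ≤ Real.sqrt β ^ 2 * ‖f w‖ ^ (2 : ℝ) := by
  simp only [Label.tens, creationFun, true_and, Real.rpow_two]
  split_ifs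
  · simp [mul_pow, abs_of_nonneg (Real.sqrt_nonneg β)]
  · simp only [norm_zero]
    exact le_trans (by norm_num) (mul_nonneg (sq_nonneg _) (sq_nonneg _))

theorem creationFun_support {r : ℕ} {U : Type*} (β : ℝ) (p q : Fin r) (u : U)
    (f : Label r U → ℂ) (w : Label r U) (hw : w ∉ Set.range (Label.tens p u)) :
    ‖creationFun β p q u f w‖ ^ (2 : ℝ) = 0 := by
  rw [creationFun_of_notMem β p q u f w hw]
  simp

theorem creationFun_summable {r : ℕ} {U : Type*} (β : ℝ) (p q : Fin r) (u : U) (f : Fock r U) :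
    Summable fun w => ‖creationFun β p q u f w‖ ^ (2 : ℝ) := by
  rw [← (tens_injective p u).summable_iff (creationFun_support β p q u f)]
  refine Summable.of_nonneg_of_le (fun w => Real.rpow_nonneg (norm_nonneg _) _)
    (fun w => norm_creationFun_tens_le β p q u f w) (Summable.mul_left _ ?_)
  simpa using (lp.memℓp f).summable (by norm_num)

theorem creationFun_memℓp {r : ℕ} {U : Type*} (β : ℝ) (p q : Fin r) (u : U) (f : Fock r U) :
    Memℓp (creationFun β p q u f) 2 :=
  memℓp_gen (by simpa using creationFun_summable β p q u f)

/-- The creation operator `℘_{p,q}(u)` as a linear map. -/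
noncomputable def creationLin {r : ℕ} {U : Type*} (β : ℝ) (p q : Fin r) (u : U) :
    Fock r U →ₗ[ℂ] Fock r U where
  toFun f := ⟨creationFun β p q u f, creationFun_memℓp β p q u f⟩
  map_add' f g := by
    apply lp.ext
    funext w
    change creationFun β p q u (f + g : Fock r U) w =
      creationFun β p q u f w + creationFun β p q u g w
    rcases w with ⟨_ | ⟨a, l⟩, s⟩
    · simp [creationFun]
    · simp only [creationFun, lp.coeFn_add, Pi.add_apply]
      split_ifs <;> ring
  map_smul' c f := by
    apply lp.ext
    funext w
    change creationFun β p q u (c • f : Fock r U) w = c * creationFun β p q u f w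
    rcases w with ⟨_ | ⟨a, l⟩, s⟩
    · simp [creationFun]
    · simp only [creationFun, lp.coeFn_smul, Pi.smul_apply, smul_eq_mul]
      split_ifs <;> ring

theorem norm_creationLin_le {r : ℕ} {U : Type*} (β : ℝ) (p q : Fin r) (u : U) (f : Fock r U) :
    ‖creationLin β p q u f‖ ≤ Real.sqrt β * ‖f‖ := by
  refine lp.norm_le_of_tsum_le (by norm_num) (by positivity) ?_
  have h2 : (2 : ENNReal).toReal = (2 : ℝ) := by norm_num
  have hf := lp.norm_rpow_eq_tsum (p := 2) (by norm_num) f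
  have hs := (lp.memℓp f).summable (p := 2) (by norm_num)
  rw [h2] at hf hs ⊢
  rw [Real.mul_rpow (Real.sqrt_nonneg β) (norm_nonneg f), hf, Real.rpow_two, ← tsum_mul_left]
  have hsup : Function.support (fun w => ‖creationFun β p q u f w‖ ^ (2 : ℝ)) ⊆
      Set.range (Label.tens p u) := fun w hw => by
    by_contra h
    exact hw (creationFun_support β p q u f w h)
  change ∑' w, ‖creationFun β p q u f w‖ ^ (2 : ℝ) ≤ _
  rw [← (tens_injective p u).tsum_eq hsup]
  exact Summable.tsum_le_tsum (fun w => norm_creationFun_tens_le β p q u f w)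
    (((tens_injective p u).summable_iff (creationFun_support β p q u f)).2
      (creationFun_summable β p q u f)) (hs.mul_left _)

/-- The matricially free creation operator `℘_{p,q}(u)` with covariance `b u p q`. It maps `Ω_q` to
`√(b u p q) e_{p,q}(u)`, maps `e_{q,s}(t) ⊗ w` to `√(b u p q) e_{p,q}(u) ⊗ e_{q,s}(t) ⊗ w`, and
maps the other basis vectors to zero (see `creation_basisVec`). -/
noncomputable def creation {r : ℕ} {U : Type*} (b : U → Matrix (Fin r) (Fin r) ℝ)
    (p q : Fin r) (u : U) : Fock r U →L[ℂ] Fock r U :=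
  (creationLin (b u p q) p q u).mkContinuous (Real.sqrt (b u p q)) (norm_creationLin_le _ p q u)

theorem creation_basisVec {r : ℕ} {U : Type*} (b : U → Matrix (Fin r) (Fin r) ℝ)
    (p q : Fin r) (u : U) (w : Label r U) :
    creation b p q u (basisVec w) =
      if Label.first w = q then (Real.sqrt (b u p q) : ℂ) • basisVec (Label.tens p u w) else 0 := by
  classical
  apply lp.ext
  funext w'
  have h : (if Label.first w = q then
      (Real.sqrt (b u p q) : ℂ) • basisVec (Label.tens p u w) else 0 : Fock r U) w' =
      if Label.first w = q then (Real.sqrt (b u p q) : ℂ) * (basisVec (Label.tens p u w)) w'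
      else 0 := by
    split_ifs <;> rfl
  rw [h]
  change creationFun (b u p q) p q u (basisVec w) w' = _
  rcases w with ⟨l, s⟩
  rcases w' with ⟨_ | ⟨a, l'⟩, s'⟩
  · simp [creationFun, basisVec, Label.tens, lp.single_apply]
  · by_cases ha : a = (p, u) <;> by_cases hl : l' = l <;> by_cases hs : s' = s <;>
      by_cases hq : Label.first (l, s) = q <;>
      simp_all [creationFun, basisVec, Label.tens, lp.single_apply]

/-- The symmetrized creation operator. -/
noncomputable def symCreation {r : ℕ} {U : Type*} (b : U → Matrix (Fin r) (Fin r) ℝ)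
    (p q : Fin r) (u : U) : Fock r U →L[ℂ] Fock r U :=
  if p = q then creation b q q u else creation b p q u + creation b q p u

/-- The symmetrized Gaussian operator: the sum of the symmetrized creation operator and its
adjoint. -/
noncomputable def symGaussian {r : ℕ} {U : Type*} (b : U → Matrix (Fin r) (Fin r) ℝ)
    (p q : Fin r) (u : U) : Fock r U →L[ℂ] Fock r U :=
  symCreation b p q u + ContinuousLinearMap.adjoint (symCreation b p q u)

end BlockGauss

/-! Both sides satisfy the same non-crossing recursion in the leftmost letter of the word.

On the matrix side one works with expectations of products of several block traces, each divided by
its block size. Expanding the leftmost symmetric block of the first word exposes a Gaussian entry `y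
j i` with `j` in block `q` and `i` in block `s`. Integration by parts (`polyExp_X_mul`,
`polyExp_entryPoly_mul`) replaces it by a derivative in the conjugate entry. If the derivative hits
a letter of the same word, the trace splits into a trace over `s` times a trace over `q`; if it hits
another trace, the two merge into one, with projections inserted to confine the summation indices
(`loop_equation`). After normalisation the splitting term carries `V n_s / n`, which tends to `V
d_s`, while the merging term carries `V / (n_q n)`, which vanishes because `n_q ≥ 1`
(`normMoment_blk_cons`). This bound does not see `d_q`, so `d_q = 0` is harmless. Induction on a
weight of lists of words then gives convergence of all these expectations to products of solutions
of the limit recursion (`tendsto_normMoment`); factorisation over traces is part of the induction.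

On the Fock space side the leftmost operator can contribute to a vacuum moment only by annihilating
a vector created by some later letter `x`. The word between the two must act as on a vacuum `Ω_s`,
and the word after `x` must return `Ω_q` to itself (`amplitude_tens`, `vacMoment_blk_cons`). The
coefficient is the squared norm `b_{s,q} = d_s V_{s,q}`, the same as in the matrix limit. -/

namespace BlockGauss

/-! ## Sums over the ways to split a list at one of its members -/

/-- The sum of `f A x B` over all decompositions `W = A ++ x :: B`. -/
def splitSum {α M : Type*} [AddCommMonoid M] :
    List α → (List α → α → List α → M) → M
  | [], _ => 0
  | x :: W, f => f [] x W + splitSum W fun A y B => f (x :: A) y B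

section SplitSum

variable {α M : Type*} [AddCommMonoid M]

theorem splitSum_nil (f : List α → α → List α → M) : splitSum [] f = 0 := rfl

theorem splitSum_cons (x : α) (W : List α) (f : List α → α → List α → M) :
    splitSum (x :: W) f = f [] x W + splitSum W fun A y B => f (x :: A) y B := rfl

theorem splitSum_congr {W : List α} {f g : List α → α → List α → M}
    (h : ∀ A x B, W = A ++ x :: B → f A x B = g A x B) : splitSum W f = splitSum W g := by
  induction W generalizing f g with
  | nil => rfl
  | cons x W ih =>
    rw [splitSum_cons, splitSum_cons, h [] x W rfl, ih]
    intro A y B hW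
    exact h (x :: A) y B (by rw [hW]; rfl)

theorem map_splitSum {M' G : Type*} [AddCommMonoid M'] [FunLike G M M'] [AddMonoidHomClass G M M']
    (g : G) (W : List α) (f : List α → α → List α → M) :
    g (splitSum W f) = splitSum W fun A x B => g (f A x B) := by
  induction W generalizing f with
  | nil => exact map_zero g
  | cons x W ih => rw [splitSum_cons, splitSum_cons, map_add, ih]

theorem splitSum_add (W : List α) (f g : List α → α → List α → M) :
    splitSum W (fun A x B => f A x B + g A x B) = splitSum W f + splitSum W g := by
  induction W generalizing f g with
  | nil => simp [splitSum_nil]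
  | cons x W ih =>
    rw [splitSum_cons, splitSum_cons, splitSum_cons, ih]
    abel

theorem splitSum_zero (W : List α) : splitSum W (fun _ _ _ => (0 : M)) = 0 := by
  induction W with
  | nil => rfl
  | cons x W ih => rw [splitSum_cons, ih, add_zero]

theorem sum_splitSum {ι : Type*} (s : Finset ι) (W : List α) (f : ι → List α → α → List α → M) :
    ∑ i ∈ s, splitSum W (f i) = splitSum W fun A x B => ∑ i ∈ s, f i A x B := by
  induction W generalizing f with
  | nil => exact Finset.sum_const_zero
  | cons x W ih => simp only [splitSum_cons, Finset.sum_add_distrib, ih]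

theorem mul_splitSum {R : Type*} [NonUnitalNonAssocSemiring R] (c : R) (W : List α)
    (f : List α → α → List α → R) :
    c * splitSum W f = splitSum W fun A x B => c * f A x B :=
  map_splitSum (AddMonoidHom.mulLeft c) W f

theorem splitSum_mul {R : Type*} [NonUnitalNonAssocSemiring R] (c : R) (W : List α)
    (f : List α → α → List α → R) :
    splitSum W f * c = splitSum W fun A x B => f A x B * c :=
  map_splitSum (AddMonoidHom.mulRight c) W f

/-- Splitting a list twice: the second split may be taken in the right or in the left part. -/
theorem splitSum_splitSum (W : List α)
    (f : List α → α → List α → α → List α → M) :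
    splitSum W (fun A x R => splitSum R fun B y C => f A x B y C) =
      splitSum W (fun L y C => splitSum L fun A x B => f A x B y C) := by
  induction W generalizing f with
  | nil => rfl
  | cons z W ih =>
    simp only [splitSum_cons, splitSum_nil, zero_add]
    rw [ih fun A x B y C => f (z :: A) x B y C, splitSum_add]

theorem tendsto_splitSum {ι : Type*} {l : Filter ι} [TopologicalSpace M] [ContinuousAdd M]
    (W : List α) {f : ι → List α → α → List α → M} {g : List α → α → List α → M}
    (h : ∀ A x B, W = A ++ x :: B → Tendsto (fun i => f i A x B) l (𝓝 (g A x B))) :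
    Tendsto (fun i => splitSum W (f i)) l (𝓝 (splitSum W g)) := by
  induction W generalizing f g with
  | nil => exact tendsto_const_nhds
  | cons x W ih =>
    simp only [splitSum_cons]
    refine (h [] x W rfl).add (ih ?_)
    intro A y B hW
    exact h (x :: A) y B (by rw [hW]; rfl)

/-- The Leibniz rule for a derivation and the product over a list. -/
theorem derivation_list_prod {k Q : Type*} [CommRing k] [CommRing Q] [Algebra k Q]
    (D : Derivation k Q Q) (t : α → Q) (L : List α) :
    D (L.map t).prod =
      splitSum L fun L₁ w L₂ => D (t w) * ((L₁ ++ L₂).map t).prod := by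
  induction L with
  | nil => simp [splitSum_nil]
  | cons x L ih =>
    rw [splitSum_cons, List.map_cons, List.prod_cons, Derivation.leibniz, ih, smul_eq_mul,
      smul_eq_mul, mul_splitSum, add_comm, List.nil_append, mul_comm (D (t x))]
    congr 1
    refine splitSum_congr fun A y B _ => ?_
    simp only [List.cons_append, List.map_cons, List.prod_cons]
    ring

end SplitSum

/-! ## Words in the symmetric blocks and in the block projections -/

/-- A letter of a word: `blk p q u` stands for the symmetric block `T_{p,q}(u)` and `proj s` for
the projection `D_s`. -/
inductive Letter (r : ℕ) (U : Type*) where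
  | blk (p q : Fin r) (u : U)
  | proj (s : Fin r)

/-- The unordered pairs `{p, q}` and `{a, b}` agree. -/
def SamePair {r : ℕ} (p q a b : Fin r) : Prop := (p = a ∧ q = b) ∨ (p = b ∧ q = a)

instance {r : ℕ} (p q a b : Fin r) : Decidable (SamePair p q a b) :=
  inferInstanceAs (Decidable (_ ∨ _))

theorem samePair_comm {r : ℕ} {p q a b : Fin r} : SamePair p q a b ↔ SamePair p q b a :=
  Or.comm

open Classical in
/-- `1` if the letter contains the entries of the matrix `u` between the blocks `a` and `b`,
and `0` otherwise. -/
noncomputable def linkCoef {r : ℕ} {U : Type*} (R : Type*) [Zero R] [One R] (u : U) (a b : Fin r) :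
    Letter r U → R
  | .blk p q t => if t = u ∧ SamePair p q a b then 1 else 0
  | .proj _ => 0

theorem map_linkCoef {r : ℕ} {U R R' G : Type*} [NonAssocSemiring R] [NonAssocSemiring R']
    [FunLike G R R'] [RingHomClass G R R'] (g : G)
    (u : U) (a b : Fin r) (x : Letter r U) : g (linkCoef R u a b x) = linkCoef R' u a b x := by
  cases x with
  | blk p q t =>
    simp only [linkCoef]
    split_ifs <;> simp
  | proj s => exact map_zero g

section Words

variable {r n : ℕ} {U Q : Type*} [CommRing Q] (y : U → Fin n → Fin n → Q) (β : Fin n → Fin r)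

/-- The matrix of a letter, where `y u` is the matrix with label `u` and `β j` is the block of
the coordinate `j`. -/
def letterMat : Letter r U → Matrix (Fin n) (Fin n) Q
  | .blk p q u => Matrix.of fun j i => if SamePair p q (β j) (β i) then y u j i else 0
  | .proj s => Matrix.diagonal fun j => if β j = s then 1 else 0

/-- The product of the matrices of the letters of a word. -/
def wordMat (W : List (Letter r U)) : Matrix (Fin n) (Fin n) Q := (W.map (letterMat y β)).prod

theorem wordMat_nil : wordMat y β [] = 1 := rfl

theorem wordMat_cons (x : Letter r U) (W : List (Letter r U)) :
    wordMat y β (x :: W) = letterMat y β x * wordMat y β W := by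
  simp [wordMat]

theorem wordMat_append (A B : List (Letter r U)) :
    wordMat y β (A ++ B) = wordMat y β A * wordMat y β B := by
  simp [wordMat]

/-- The trace of the matrix of a word over the block `q`. -/
def blockTr (q : Fin r) (W : List (Letter r U)) : Q :=
  ∑ j with β j = q, wordMat y β W j j

/-- The product of the block traces of several words. -/
def multiTr (L : List (Fin r × List (Letter r U))) : Q :=
  (L.map fun w => blockTr y β w.1 w.2).prod

theorem multiTr_cons (w : Fin r × List (Letter r U)) (L : List (Fin r × List (Letter r U))) :
    multiTr y β (w :: L) = blockTr y β w.1 w.2 * multiTr y β L := by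
  simp [multiTr]

theorem blockTr_nil (q : Fin r) :
    blockTr y β q [] = ((Finset.univ.filter fun j => β j = q).card : Q) := by
  simp [blockTr, wordMat_nil]

theorem wordMat_proj_cons (s : Fin r) (W : List (Letter r U)) (i k : Fin n) :
    wordMat y β (.proj s :: W) i k = if β i = s then wordMat y β W i k else 0 := by
  rw [wordMat_cons, letterMat, Matrix.diagonal_mul, ite_mul, one_mul, zero_mul]

theorem blockTr_proj_cons (q s : Fin r) (W : List (Letter r U)) :
    blockTr y β q (.proj s :: W) = if q = s then blockTr y β q W else 0 := by
  have h : ∀ j ∈ Finset.univ.filter (fun j => β j = q),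
      wordMat y β (.proj s :: W) j j = if q = s then wordMat y β W j j else 0 := by
    intro j hj
    rw [Finset.mem_filter] at hj
    rw [wordMat_proj_cons, hj.2]
  rw [blockTr, Finset.sum_congr rfl h, blockTr]
  split_ifs <;> simp

theorem sum_block (f : Fin n → Q) : ∑ j, f j = ∑ s : Fin r, ∑ j with β j = s, f j :=
  (Finset.sum_fiberwise Finset.univ β f).symm

/-- Sorting the second index of the leading entry by its block `s` exposes the Gaussian entry whose
variance depends only on `q` and `s`. -/
theorem blockTr_blk_cons (q p p' : Fin r) (u : U) (W : List (Letter r U)) :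
    blockTr y β q (.blk p p' u :: W) =
      ∑ s, if SamePair p p' q s then
        ∑ j with β j = q, ∑ i with β i = s, y u j i * wordMat y β W i j else 0 := by
  simp only [blockTr, wordMat_cons, letterMat, Matrix.mul_apply, Matrix.of_apply]
  have h : ∀ j ∈ Finset.univ.filter (fun j => β j = q),
      ∑ i, (if SamePair p p' (β j) (β i) then y u j i else 0) * wordMat y β W i j =
      ∑ s, if SamePair p p' q s then ∑ i with β i = s, y u j i * wordMat y β W i j else 0 := by
    intro j hj
    rw [sum_block β]
    refine Finset.sum_congr rfl fun s _ => ?_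
    rw [Finset.mem_filter] at hj
    split_ifs with hs
    · refine Finset.sum_congr rfl fun i hi => ?_
      rw [Finset.mem_filter] at hi
      rw [hj.2, hi.2, if_pos hs]
    · refine Finset.sum_eq_zero fun i hi => ?_
      rw [Finset.mem_filter] at hi
      rw [hj.2, hi.2, if_neg hs, zero_mul]
  rw [Finset.sum_congr rfl h, Finset.sum_comm]
  refine Finset.sum_congr rfl fun s _ => ?_
  split_ifs <;> simp

/-- The two projections restrict the inner indices `i` and `j` to the blocks `s` and `q`. Read from
right to left, this glues two traces into one: it is the merging term of the loop equation. -/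
theorem blockTr_proj_insert (q' s q : Fin r) (A W B : List (Letter r U)) :
    blockTr y β q' (A ++ .proj s :: (W ++ .proj q :: B)) =
      ∑ k with β k = q', ∑ j with β j = q, ∑ i with β i = s,
        wordMat y β W i j * (wordMat y β A k i * wordMat y β B j k) := by
  rw [blockTr]
  refine Finset.sum_congr rfl fun k _ => ?_
  have h : ∀ i, wordMat y β (.proj s :: (W ++ .proj q :: B)) i k =
      if β i = s then ∑ j with β j = q, wordMat y β W i j * wordMat y β B j k else 0 := by
    intro i
    rw [wordMat_proj_cons, wordMat_append, Matrix.mul_apply, Finset.sum_filter]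
    simp only [wordMat_proj_cons, mul_ite, mul_zero]
  rw [wordMat_append, Matrix.mul_apply, Finset.sum_comm]
  simp only [h, mul_ite, mul_zero]
  rw [← Finset.sum_filter]
  refine Finset.sum_congr rfl fun i _ => ?_
  rw [Finset.mul_sum]
  refine Finset.sum_congr rfl fun j _ => ?_
  ring

variable [Algebra ℂ Q] {y}

/-- By the Leibniz rule, differentiating in the entry `(a, b)` removes one letter at a time and
leaves the matrix unit at `(a, b)` in its place, which cuts the word into two. -/
theorem derivation_wordMat [DecidableEq U] {D : Derivation ℂ Q Q} {u : U} {a b : Fin n}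
    (hD : ∀ t i j, D (y t i j) = if t = u ∧ i = a ∧ j = b then 1 else 0)
    (W : List (Letter r U)) (j l : Fin n) :
    D (wordMat y β W j l) = splitSum W fun A x B =>
      linkCoef Q u (β a) (β b) x * (wordMat y β A j a * wordMat y β B b l) := by
  have hT : ∀ (x : Letter r U) (i k : Fin n), D (letterMat y β x i k) =
      if i = a ∧ k = b then linkCoef Q u (β a) (β b) x else 0 := by
    intro x i k
    cases x with
    | blk p q t =>
      simp only [letterMat, linkCoef, Matrix.of_apply]
      by_cases hik : i = a ∧ k = b
      · obtain ⟨rfl, rfl⟩ := hik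
        by_cases hp : SamePair p q (β i) (β k) <;> by_cases ht : t = u <;> simp [hp, ht, hD]
      · have : ¬ (t = u ∧ i = a ∧ k = b) := fun h => hik h.2
        rw [if_neg hik]
        split_ifs
        · rw [hD, if_neg this]
        · exact map_zero D
    | proj s =>
      simp only [letterMat, linkCoef, Matrix.diagonal_apply]
      split_ifs <;> simp
  induction W generalizing j l with
  | nil =>
    rw [wordMat_nil, splitSum_nil, Matrix.one_apply]
    split_ifs <;> simp
  | cons x W ih =>
    rw [wordMat_cons, Matrix.mul_apply, map_sum, splitSum_cons]
    simp only [Derivation.leibniz, smul_eq_mul, Finset.sum_add_distrib]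
    rw [add_comm]
    congr 1
    · rw [wordMat_nil, Matrix.one_apply]
      simp only [hT]
      by_cases hj : j = a
      · simp [hj, mul_comm]
      · simp [hj]
    · simp only [ih, mul_splitSum, sum_splitSum]
      refine splitSum_congr fun A x' B _ => ?_
      rw [wordMat_cons, Matrix.mul_apply, Finset.sum_mul, Finset.mul_sum]
      refine Finset.sum_congr rfl fun k _ => ?_
      ring

/-- The loop equation: Gaussian integration by parts in a product of block traces. -/
theorem loop_equation [DecidableEq U] (D : U → Fin n → Fin n → Derivation ℂ Q Q)
    (hD : ∀ u a b t i j, D u a b (y t i j) = if t = u ∧ i = a ∧ j = b then 1 else 0)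
    (E : Q →ₗ[ℂ] ℂ) (c : U → Fin r → Fin r → ℂ)
    (hE : ∀ u a b P, E (y u a b * P) = c u (β a) (β b) * E (D u b a P))
    (q p p' : Fin r) (u : U) (W : List (Letter r U)) (L : List (Fin r × List (Letter r U))) :
    E (multiTr y β ((q, .blk p p' u :: W) :: L)) =
      ∑ s, if SamePair p p' q s then c u q s *
        ((splitSum W fun A x B =>
            linkCoef ℂ u s q x * E (multiTr y β ((s, A) :: (q, B) :: L))) +
          splitSum L fun L₁ w L₂ => splitSum w.2 fun A x B =>
            linkCoef ℂ u s q x * E (multiTr y β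
              ((w.1, A ++ .proj s :: (W ++ .proj q :: B)) :: (L₁ ++ L₂)))) else 0 := by
  have hcoef : ∀ (x : Letter r U) (s : Fin r) (P : Q),
      E (linkCoef Q u s q x * P) = linkCoef ℂ u s q x * E P := by
    intro x s P
    rw [← map_linkCoef (algebraMap ℂ Q), ← Algebra.smul_def, map_smul, smul_eq_mul]
  rw [multiTr_cons, blockTr_blk_cons, Finset.sum_mul, map_sum]
  refine Finset.sum_congr rfl fun s _ => ?_
  split_ifs with hs
  swap
  · simp
  -- Integration by parts entry by entry. The indices of the derivation are transposed since in a
  -- Hermitian matrix the entry `(j, i)` is correlated with its conjugate `(i, j)`.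
  have h1 : E ((∑ j with β j = q, ∑ i with β i = s, y u j i * wordMat y β W i j) *
      multiTr y β L) = c u q s * E (∑ j with β j = q, ∑ i with β i = s,
        D u i j (wordMat y β W i j * multiTr y β L)) := by
    simp only [Finset.sum_mul, map_sum, Finset.mul_sum]
    refine Finset.sum_congr rfl fun j hj => Finset.sum_congr rfl fun i hi => ?_
    rw [Finset.mem_filter] at hj hi
    rw [mul_assoc, hE, hj.2, hi.2]
  rw [h1]
  congr 1
  -- The derivative of `W` splits its trace in two; the derivative of `multiTr y β L` hits one
  -- factor `w` and merges it with `W`.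
  have h2 : ∑ j with β j = q, ∑ i with β i = s, D u i j (wordMat y β W i j * multiTr y β L) =
      (splitSum W fun A x B =>
          linkCoef Q u s q x * multiTr y β ((s, A) :: (q, B) :: L)) +
        splitSum L fun L₁ w L₂ => splitSum w.2 fun A x B =>
          linkCoef Q u s q x * multiTr y β
            ((w.1, A ++ .proj s :: (W ++ .proj q :: B)) :: (L₁ ++ L₂)) := by
    simp only [Derivation.leibniz, smul_eq_mul, Finset.sum_add_distrib]
    rw [add_comm]
    congr 1
    · simp only [derivation_wordMat β (hD u _ _), mul_splitSum, sum_splitSum]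
      refine splitSum_congr fun A x B _ => ?_
      rw [multiTr_cons, multiTr_cons, blockTr, blockTr, ← mul_assoc (Finset.sum _ _),
        mul_comm (Finset.sum _ _) (Finset.sum _ _), Finset.sum_mul_sum, Finset.sum_mul,
        Finset.mul_sum]
      refine Finset.sum_congr rfl fun j hj => ?_
      rw [Finset.sum_mul, Finset.mul_sum]
      refine Finset.sum_congr rfl fun i hi => ?_
      rw [Finset.mem_filter] at hj hi
      rw [hj.2, hi.2]
      ring
    · have hDm : ∀ i j, D u i j (multiTr y β L) = splitSum L fun L₁ w L₂ =>
          D u i j (blockTr y β w.1 w.2) * multiTr y β (L₁ ++ L₂) := fun i j =>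
        derivation_list_prod (D u i j) (fun w : Fin r × List (Letter r U) => blockTr y β w.1 w.2) L
      have hDt : ∀ i j q' W', D u i j (blockTr y β q' W') = splitSum W' fun A x B =>
          ∑ k with β k = q', linkCoef Q u (β i) (β j) x *
            (wordMat y β A k i * wordMat y β B j k) := fun i j q' W' => by
        rw [blockTr, map_sum]
        simp only [derivation_wordMat β (hD u _ _), sum_splitSum]
      simp only [hDm, hDt, mul_splitSum, sum_splitSum, splitSum_mul]
      refine splitSum_congr fun L₁ w L₂ _ => splitSum_congr fun A x B _ => ?_
      rw [multiTr_cons, blockTr_proj_insert]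
      simp only [Finset.sum_mul, Finset.mul_sum]
      refine Eq.trans (Finset.sum_congr rfl fun j hj => ?_) Finset.sum_comm
      refine Finset.sum_comm.trans <| Finset.sum_congr rfl fun k _ =>
        Finset.sum_congr rfl fun i hi => ?_
      rw [Finset.mem_filter] at hj hi
      rw [hj.2, hi.2]
      ring
  rw [h2, map_add, map_splitSum, map_splitSum]
  congr 1
  · simp only [hcoef]
  · simp only [map_splitSum, hcoef]

end Words

/-! ## The limit of the normalised products of block traces -/

section Normalised

variable {r n : ℕ} {U Q : Type*} [CommRing Q] [Algebra ℂ Q] (y : U → Fin n → Fin n → Q)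
  (β : Fin n → Fin r)

/-- The number of coordinates in the block `q`. -/
def blockCard (q : Fin r) : ℂ := ((Finset.univ.filter fun j => β j = q).card : ℂ)

/-- The value of the functional `E` at a product of block traces, each of which is divided by the
size of its block. -/
noncomputable def normMoment (E : Q →ₗ[ℂ] ℂ) (L : List (Fin r × List (Letter r U))) : ℂ :=
  (L.map fun w => (blockCard β w.1)⁻¹).prod * E (multiTr y β L)

theorem normMoment_nil {E : Q →ₗ[ℂ] ℂ} (hE : E 1 = 1) : normMoment y β E [] = 1 := by
  simp [normMoment, multiTr, hE]

theorem normMoment_nil_cons (E : Q →ₗ[ℂ] ℂ) {q : Fin r} (hq : blockCard β q ≠ 0)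
    (L : List (Fin r × List (Letter r U))) :
    normMoment y β E ((q, []) :: L) = normMoment y β E L := by
  have h : ((Finset.univ.filter fun j => β j = q).card : Q) = algebraMap ℂ Q (blockCard β q) := by
    rw [blockCard, map_natCast]
  simp only [normMoment, multiTr_cons, blockTr_nil, h, ← Algebra.smul_def, map_smul,
    List.map_cons, List.prod_cons, smul_eq_mul]
  field_simp

theorem normMoment_proj_cons (E : Q →ₗ[ℂ] ℂ) (q s : Fin r) (W : List (Letter r U))
    (L : List (Fin r × List (Letter r U))) :
    normMoment y β E ((q, .proj s :: W) :: L) =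
      if q = s then normMoment y β E ((q, W) :: L) else 0 := by
  simp only [normMoment, multiTr_cons, blockTr_proj_cons, List.map_cons, List.prod_cons]
  split_ifs <;> simp

variable {y}

/-- Splitting creates a trace over `s`, whose normalisation must be compensated by `blockCard β s`.
Merging loses the trace over `q`, so its factor `(blockCard β q)⁻¹` stays outside. -/
theorem normMoment_blk_cons [DecidableEq U] (D : U → Fin n → Fin n → Derivation ℂ Q Q)
    (hD : ∀ u a b t i j, D u a b (y t i j) = if t = u ∧ i = a ∧ j = b then 1 else 0)
    (E : Q →ₗ[ℂ] ℂ) (V : U → Fin r → Fin r → ℂ)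
    (hE : ∀ u a b P, E (y u a b * P) = V u (β a) (β b) / n * E (D u b a P))
    (hβ : ∀ s, blockCard β s ≠ 0)
    (q p p' : Fin r) (u : U) (W : List (Letter r U)) (L : List (Fin r × List (Letter r U))) :
    normMoment y β E ((q, .blk p p' u :: W) :: L) =
      ∑ s, if SamePair p p' q s then V u q s *
        (blockCard β s / n * (splitSum W fun A x B =>
            linkCoef ℂ u s q x * normMoment y β E ((s, A) :: (q, B) :: L)) +
          (blockCard β q)⁻¹ / n * splitSum L fun L₁ w L₂ => splitSum w.2 fun A x B =>
            linkCoef ℂ u s q x * normMoment y β E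
              ((w.1, A ++ .proj s :: (W ++ .proj q :: B)) :: (L₁ ++ L₂))) else 0 := by
  rw [normMoment, loop_equation β D hD E (fun u a b => V u a b / n) hE, Finset.mul_sum]
  refine Finset.sum_congr rfl fun s _ => ?_
  split_ifs
  swap
  · rw [mul_zero]
  have h1 : (splitSum W fun A x B => linkCoef ℂ u s q x *
      normMoment y β E ((s, A) :: (q, B) :: L)) =
      (blockCard β s)⁻¹ * ((blockCard β q)⁻¹ * (L.map fun w => (blockCard β w.1)⁻¹).prod) *
        splitSum W fun A x B =>
          linkCoef ℂ u s q x * E (multiTr y β ((s, A) :: (q, B) :: L)) := by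
    rw [mul_splitSum]
    refine splitSum_congr fun A x B _ => ?_
    simp only [normMoment, List.map_cons, List.prod_cons]
    ring
  have h2 : (splitSum L fun L₁ w L₂ => splitSum w.2 fun A x B => linkCoef ℂ u s q x *
      normMoment y β E ((w.1, A ++ .proj s :: (W ++ .proj q :: B)) :: (L₁ ++ L₂))) =
      (L.map fun w => (blockCard β w.1)⁻¹).prod *
        splitSum L fun L₁ w L₂ => splitSum w.2 fun A x B => linkCoef ℂ u s q x *
          E (multiTr y β ((w.1, A ++ .proj s :: (W ++ .proj q :: B)) :: (L₁ ++ L₂))) := by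
    rw [mul_splitSum]
    refine splitSum_congr fun L₁ w L₂ hL => ?_
    rw [mul_splitSum]
    refine splitSum_congr fun A x B _ => ?_
    simp only [normMoment, hL, List.map_cons, List.prod_cons, List.map_append, List.prod_append]
    ring
  rw [h1, h2, List.map_cons, List.prod_cons]
  have := hβ s
  field_simp

end Normalised

/-! ### Passage to the limit in the recursion -/

section Limit

variable {r : ℕ} {U : Type*}

/-- The weight of a letter. -/
def Letter.weight : Letter r U → ℕ
  | .blk _ _ _ => 2
  | .proj _ => 1

/-- The weight of a list of words. -/
def listWeight (L : List (Fin r × List (Letter r U))) : ℕ :=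
  (L.map fun w => (w.2.map Letter.weight).sum + 1).sum

/-- Induction on `listWeight`, which drops along every branch of the recursion. In a merge two block
letters of weight 2 become two projections of weight 1 and two words become one. The merged terms
converge by induction, so the factor `ε` kills them. -/
theorem tendsto_normMoment (F : ℕ → List (Fin r × List (Letter r U)) → ℂ)
    (φ : Fin r → List (Letter r U) → ℂ) (V : U → Fin r → Fin r → ℂ) (d : Fin r → ℂ)
    (a ε : ℕ → Fin r → ℂ) (ha : ∀ s, Tendsto (a · s) atTop (𝓝 (d s)))
    (hε : ∀ s, Tendsto (ε · s) atTop (𝓝 0))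
    (φ_nil : ∀ q, φ q [] = 1)
    (φ_proj : ∀ q s W, φ q (.proj s :: W) = if q = s then φ q W else 0)
    (φ_blk : ∀ q p p' u W, φ q (.blk p p' u :: W) = ∑ s, if SamePair p p' q s then
      V u q s * (d s * splitSum W fun A x B => linkCoef ℂ u s q x * (φ s A * φ q B)) else 0)
    (F_nil : ∀ᶠ n in atTop, F n [] = 1)
    (F_nil_cons : ∀ᶠ n in atTop, ∀ q L, F n ((q, []) :: L) = F n L)
    (F_proj : ∀ᶠ n in atTop, ∀ q s W L, F n ((q, .proj s :: W) :: L) =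
      if q = s then F n ((q, W) :: L) else 0)
    (F_blk : ∀ᶠ n in atTop, ∀ q p p' u W L, F n ((q, .blk p p' u :: W) :: L) =
      ∑ s, if SamePair p p' q s then V u q s *
        (a n s * (splitSum W fun A x B => linkCoef ℂ u s q x * F n ((s, A) :: (q, B) :: L)) +
          ε n q * splitSum L fun L₁ w L₂ => splitSum w.2 fun A x B =>
            linkCoef ℂ u s q x * F n
              ((w.1, A ++ .proj s :: (W ++ .proj q :: B)) :: (L₁ ++ L₂))) else 0)
    (L : List (Fin r × List (Letter r U))) :
    Tendsto (F · L) atTop (𝓝 (L.map fun w => φ w.1 w.2).prod) := by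
  induction hN : listWeight L using Nat.strong_induction_on generalizing L with
  | _ N ih =>
  subst hN
  rcases L with _ | ⟨⟨q, _ | ⟨x, W⟩⟩, L⟩
  · simpa using tendsto_const_nhds.congr' (F_nil.mono fun n h => h.symm)
  · have := ih _ (by simp [listWeight]) L rfl
    simp only [List.map_cons, List.prod_cons, φ_nil, one_mul]
    exact this.congr' (F_nil_cons.mono fun n h => (h q L).symm)
  · cases x with
    | proj s =>
      simp only [List.map_cons, List.prod_cons, φ_proj]
      refine Tendsto.congr' (F_proj.mono fun n h => (h q s W L).symm) ?_
      split_ifs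
      · simpa using ih _ (by simp [listWeight, Letter.weight]) ((q, W) :: L) rfl
      · simp
    | blk p p' u =>
      simp only [List.map_cons, List.prod_cons, φ_blk]
      refine Tendsto.congr' (F_blk.mono fun n h => (h q p p' u W L).symm) ?_
      rw [Finset.sum_mul]
      refine tendsto_finsetSum _ fun s _ => ?_
      split_ifs
      swap
      · simp
      rw [mul_assoc, mul_assoc, splitSum_mul]
      refine Tendsto.const_mul _ ?_
      rw [← add_zero (d s * _)]
      refine ((ha s).mul (tendsto_splitSum W fun A x B hW => ?_)).add ?_
      · by_cases hx : linkCoef ℂ u s q x = 0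
        · simp [hx]
        have := ih (listWeight ((s, A) :: (q, B) :: L)) (by
          cases x
          · simp [listWeight, Letter.weight, hW]
            omega
          · simp [linkCoef] at hx) _ rfl
        simpa [mul_assoc] using this.const_mul (linkCoef ℂ u s q x)
      · have h2 := tendsto_splitSum (l := atTop) L
          (f := fun n L₁ w L₂ => splitSum w.2 fun A x B => linkCoef ℂ u s q x * F n
              ((w.1, A ++ .proj s :: (W ++ .proj q :: B)) :: (L₁ ++ L₂)))
          (g := fun L₁ w L₂ => splitSum w.2 fun A x B => linkCoef ℂ u s q x *
              (((w.1, A ++ .proj s :: (W ++ .proj q :: B)) :: (L₁ ++ L₂)).map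
                fun w => φ w.1 w.2).prod) (fun L₁ w L₂ hL => tendsto_splitSum w.2
            fun A x B hw => by
              by_cases hx : linkCoef ℂ u s q x = 0
              · simp [hx]
              refine (ih _ ?_ _ rfl).const_mul _
              cases x
              · simp [listWeight, Letter.weight, hL, hw]
                omega
              · simp [linkCoef] at hx)
        simpa using (hε q).mul h2

end Limit

/-! ## Vacuum moments on the matricially free Fock space -/

section Amplitudes

variable {r : ℕ} {U : Type*}

open Classical in
/-- Coordinates of the image of a vector under the symmetrized creation operator of the letter
`blk p q u`, with the square roots of the covariances given by `σ`. -/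
noncomputable def createAct (σ : U → Fin r → Fin r → ℂ) (p q : Fin r) (u : U)
    (f : Label r U → ℂ) : Label r U → ℂ
  | ([], _) => 0
  | (a :: l, s) => if a.2 = u ∧ SamePair p q a.1 (Label.first (l, s)) then
      σ u a.1 (Label.first (l, s)) * f (l, s) else 0

/-- Coordinates of the image of a vector under the symmetrized Gaussian operator of a letter
`blk p q u`, and under the projection onto the span of the basis vectors with first index `s` in
the case of a letter `proj s`. -/
noncomputable def letterAct (σ : U → Fin r → Fin r → ℂ) :
    Letter r U → (Label r U → ℂ) → Label r U → ℂ
  | .blk p q u, f, w => createAct σ p q u f w +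
    ∑ s, if SamePair p q s w.first then σ u s w.first * f (Label.tens s u w) else 0
  | .proj s, f, w => if w.first = s then f w else 0

open Classical in
/-- Coordinates of the vector obtained by applying the operators of a word to `Ω_q`. -/
noncomputable def amplitude (σ : U → Fin r → Fin r → ℂ) (q : Fin r) :
    List (Letter r U) → Label r U → ℂ
  | [] => fun w => if w = ([], q) then 1 else 0
  | x :: W => letterAct σ x (amplitude σ q W)

/-- The vacuum moment of a word. -/
noncomputable def vacMoment (σ : U → Fin r → Fin r → ℂ) (q : Fin r) (W : List (Letter r U)) : ℂ :=
  amplitude σ q W ([], q)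

theorem vacMoment_nil (σ : U → Fin r → Fin r → ℂ) (q : Fin r) :
    vacMoment σ q ([] : List (Letter r U)) = 1 := by
  simp [vacMoment, amplitude]

theorem vacMoment_proj_cons (σ : U → Fin r → Fin r → ℂ) (q s : Fin r) (W : List (Letter r U)) :
    vacMoment σ q (.proj s :: W) = if q = s then vacMoment σ q W else 0 := rfl

theorem vacMoment_blk_cons_eq_sum (σ : U → Fin r → Fin r → ℂ) (q p p' : Fin r) (u : U)
    (W : List (Letter r U)) :
    vacMoment σ q (.blk p p' u :: W) = ∑ s, if SamePair p p' s q then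
      σ u s q * amplitude σ q W (Label.tens s u ([], q)) else 0 := by
  -- A creation operator has no vacuum component, so only the annihilation part survives.
  exact zero_add _

/-- Decomposition of an amplitude at the last creation of the first factor of the basis vector. -/
theorem amplitude_tens (σ : U → Fin r → Fin r → ℂ) (q : Fin r) (W : List (Letter r U))
    (p : Fin r) (t : U) (w : Label r U) :
    amplitude σ q W (Label.tens p t w) = splitSum W fun A x B =>
      linkCoef ℂ t p w.first x * (σ t p w.first * (vacMoment σ p A * amplitude σ q B w)) := by
  induction hN : W.length using Nat.strong_induction_on generalizing q W p t w with
  | _ N ih =>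
  subst hN
  rcases W with _ | ⟨z, W⟩
  · simp [amplitude, splitSum_nil, Label.tens]
  rw [splitSum_cons]
  cases z with
  | proj s =>
    simp only [amplitude, letterAct, linkCoef, vacMoment_proj_cons, zero_mul, zero_add]
    rw [ih W.length (by simp) q W p t w rfl]
    change (if p = s then _ else _) = _
    split_ifs
    · rfl
    · simp [splitSum_zero]
  | blk p₁ p₂ u =>
    simp only [amplitude, letterAct]
    congr 1
    · simp only [Label.tens, createAct, linkCoef, vacMoment_nil, one_mul, ite_mul, zero_mul]
      by_cases ht : t = u
      · subst ht
        simp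
      · simp [ht, Ne.symm ht]
    -- The leading letter annihilates an extra factor lying on top of the factor `(p, t)`.
    · change (∑ s, if SamePair p₁ p₂ s p then σ u s p * _ else 0) = _
      have h1 : ∀ s, amplitude σ q W (Label.tens s u (Label.tens p t w)) =
          splitSum W fun A x R => splitSum R fun B y C =>
            linkCoef ℂ u s p x * (σ u s p * (vacMoment σ s A *
              (linkCoef ℂ t p w.first y * (σ t p w.first *
                (vacMoment σ p B * amplitude σ q C w))))) := by
        intro s
        rw [ih W.length (by simp) q W s u _ rfl]
        refine splitSum_congr fun A x R hW => ?_
        rw [ih R.length (by simp [hW]; omega) q R p t w rfl]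
        simp only [mul_splitSum]
        rfl
      -- Here `y` is the last creation of the factor `(p, t)`. The leading letter is paired with a
      -- letter inside `A`, so both belong to one vacuum moment at `p`; `splitSum_splitSum` regroups
      -- the double split accordingly.
      have h2 : ∀ A y C, W = A ++ y :: C → vacMoment σ p (.blk p₁ p₂ u :: A) =
          ∑ s, if SamePair p₁ p₂ s p then σ u s p * splitSum A fun A x B =>
            linkCoef ℂ u s p x * (σ u s p * (vacMoment σ s A * vacMoment σ p B)) else 0 := by
        intro A y C hW
        rw [vacMoment_blk_cons_eq_sum]
        refine Finset.sum_congr rfl fun s _ => ?_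
        rw [ih A.length (by simp [hW]) p A s u _ rfl]
        rfl
      simp only [h1]
      rw [splitSum_congr (g := fun A y C => ∑ s, if SamePair p₁ p₂ s p then
        σ u s p * splitSum A fun A x B => linkCoef ℂ u s p x * (σ u s p * (vacMoment σ s A *
              (linkCoef ℂ t p w.first y * (σ t p w.first *
                (vacMoment σ p B * amplitude σ q C w))))) else 0) ?_]
      · rw [← sum_splitSum]
        refine Finset.sum_congr rfl fun s _ => ?_
        split_ifs
        · rw [splitSum_splitSum, mul_splitSum]
        · rw [splitSum_zero]
      · intro A y C hW
        rw [h2 A y C hW, Finset.sum_mul, Finset.mul_sum, Finset.mul_sum]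
        refine Finset.sum_congr rfl fun s _ => ?_
        split_ifs
        · simp only [mul_splitSum, splitSum_mul]
          refine splitSum_congr fun A x B _ => ?_
          ring
        · simp

/-- The leading letter annihilates the factor last created at `x`. One factor `σ` comes from the
creation, the other from the annihilation. -/
theorem vacMoment_blk_cons (σ : U → Fin r → Fin r → ℂ) (q p p' : Fin r) (u : U)
    (W : List (Letter r U)) :
    vacMoment σ q (.blk p p' u :: W) = ∑ s, if SamePair p p' q s then
      σ u s q ^ 2 * splitSum W fun A x B =>
        linkCoef ℂ u s q x * (vacMoment σ s A * vacMoment σ q B) else 0 := by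
  rw [vacMoment_blk_cons_eq_sum]
  refine Finset.sum_congr rfl fun s _ => if_congr samePair_comm ?_ rfl
  rw [amplitude_tens, mul_splitSum, mul_splitSum]
  refine splitSum_congr fun A x B _ => ?_
  change _ * (_ * (σ u s q * (_ * vacMoment σ q B))) = _
  simp only [Label.first]
  ring

end Amplitudes

/-! ### The Hilbert space operators in coordinates -/

section Operators

variable {r : ℕ} {U : Type*}

theorem inner_basisVec (w : Label r U) (f : Fock r U) : inner ℂ (basisVec w) f = f w := by
  classical
  rw [basisVec, lp.inner_single_left]
  simp

theorem adjoint_apply_label (T : Fock r U →L[ℂ] Fock r U) (f : Fock r U) (w : Label r U) :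
    ContinuousLinearMap.adjoint T f w = inner ℂ (T (basisVec w)) f := by
  rw [← inner_basisVec, ContinuousLinearMap.adjoint_inner_right]

theorem inner_creation_basisVec (b : U → Matrix (Fin r) (Fin r) ℝ) (p q : Fin r) (u : U)
    (w : Label r U) (f : Fock r U) :
    inner ℂ (creation b p q u (basisVec w)) f =
      if w.first = q then (Real.sqrt (b u p q) : ℂ) * f (Label.tens p u w) else 0 := by
  rw [creation_basisVec]
  split_ifs
  · rw [inner_smul_left, inner_basisVec, Complex.conj_ofReal]
  · exact inner_zero_left _

theorem symCreation_apply (b : U → Matrix (Fin r) (Fin r) ℝ) (p q : Fin r) (u : U)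
    (f : Fock r U) (w : Label r U) :
    symCreation b p q u f w =
      createAct (fun u p q => (Real.sqrt (b u p q) : ℂ)) p q u f w := by
  have hc : ∀ p q, creation b p q u f w = creationFun (b u p q) p q u f w := fun _ _ => rfl
  by_cases hpq : p = q
  · subst hpq
    rw [symCreation, if_pos rfl, hc]
    rcases w with ⟨_ | ⟨⟨a, t⟩, l⟩, s⟩
    · rfl
    · simp only [creationFun, createAct, SamePair, Prod.mk.injEq]
      grind
  · have : symCreation b p q u f w = creation b p q u f w + creation b q p u f w := by
      rw [symCreation, if_neg hpq]
      rfl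
    rw [this, hc, hc]
    clear this hc
    rcases w with ⟨_ | ⟨⟨a, t⟩, l⟩, s⟩
    · simp [creationFun, createAct]
    · simp only [creationFun, createAct, SamePair, Prod.mk.injEq]
      generalize Label.first (l, s) = k
      by_cases ht : t = u
      · by_cases hp : a = p
        · subst hp
          rcases eq_or_ne k q with rfl | hk
          · simp [ht, hpq]
          · simp [ht, hpq, Ne.symm hpq, hk, hk.symm]
        · rcases eq_or_ne a q with rfl | hq
          · rcases eq_or_ne k p with rfl | hk
            · simp [ht, hpq, hp]
            · simp [ht, hpq, hp, hk, hk.symm]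
          · simp [hp, hq, Ne.symm hp, Ne.symm hq]
      · simp [ht]

/-- By `adjoint_apply_label` this is a coordinate of the image of `f` under the adjoint, that is,
the annihilation half of `letterAct`. -/
theorem inner_symCreation_basisVec (b : U → Matrix (Fin r) (Fin r) ℝ) (p q : Fin r) (u : U)
    (w : Label r U) (f : Fock r U) :
    inner ℂ (symCreation b p q u (basisVec w)) f =
      ∑ s, if SamePair p q s w.first then
        (Real.sqrt (b u s w.first) : ℂ) * f (Label.tens s u w) else 0 := by
  by_cases hpq : p = q
  · subst hpq
    rw [symCreation, if_pos rfl, inner_creation_basisVec, Finset.sum_eq_single p]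
    · by_cases h : w.first = p
      · simp [SamePair, h]
      · simp [SamePair, h, Ne.symm h]
    · intro s _ hs
      simp [SamePair, hs.symm]
    · simp
  · have : symCreation b p q u (basisVec w) =
        creation b p q u (basisVec w) + creation b q p u (basisVec w) := by
      rw [symCreation, if_neg hpq]
      rfl
    rw [this, inner_add_left, inner_creation_basisVec, inner_creation_basisVec,
      Fintype.sum_eq_add p q hpq]
    · clear this
      generalize w.first = k
      rcases eq_or_ne k p with rfl | hp
      · simp [SamePair, hpq, Ne.symm hpq]
      · rcases eq_or_ne k q with rfl | hq
        · simp [SamePair, hpq, hp]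
        · simp [SamePair, hp, hq, hp.symm, hq.symm]
    · rintro s ⟨hsp, hsq⟩
      simp [SamePair, hsp.symm, hsq.symm]

theorem symGaussian_apply (b : U → Matrix (Fin r) (Fin r) ℝ) (p q : Fin r) (u : U)
    (f : Fock r U) (w : Label r U) :
    symGaussian b p q u f w =
      letterAct (fun u p q => (Real.sqrt (b u p q) : ℂ)) (.blk p q u) f w := by
  have hadd : symGaussian b p q u f w =
      symCreation b p q u f w + ContinuousLinearMap.adjoint (symCreation b p q u) f w := rfl
  rw [hadd, letterAct, symCreation_apply, adjoint_apply_label, inner_symCreation_basisVec]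

theorem amplitude_map_blk (b : U → Matrix (Fin r) (Fin r) ℝ) (q₀ : Fin r)
    (L : List (Fin r × Fin r × U)) (w : Label r U) :
    (L.map fun x => symGaussian b x.1 x.2.1 x.2.2).prod (vacuum U q₀) w =
      amplitude (fun u p q => (Real.sqrt (b u p q) : ℂ)) q₀
        (L.map fun x => .blk x.1 x.2.1 x.2.2) w := by
  classical
  induction L generalizing w with
  | nil =>
    simp only [List.map_nil, List.prod_nil, amplitude, vacuum, basisVec]
    change lp.single 2 _ _ w = _
    rw [lp.single_apply]
    simp [Pi.single_apply]
  | cons x L ih =>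
    rw [List.map_cons, List.map_cons, List.prod_cons, amplitude, mul_apply_eq_comp,
      symGaussian_apply]
    congr 1
    exact funext ih

theorem vacState_prod (b : U → Matrix (Fin r) (Fin r) ℝ) (q₀ : Fin r)
    (L : List (Fin r × Fin r × U)) :
    vacState q₀ (L.map fun x => symGaussian b x.1 x.2.1 x.2.2).prod =
      vacMoment (fun u p q => (Real.sqrt (b u p q) : ℂ)) q₀
        (L.map fun x => .blk x.1 x.2.1 x.2.2) := by
  rw [vacState, vacuum, inner_basisVec]
  exact amplitude_map_blk b q₀ L _

end Operators

/-! ## Gaussian integration by parts for polynomials -/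

section Gaussian

open scoped NNReal ENNReal

theorem integrable_pow_gaussianReal (v : ℝ≥0) (a : ℕ) :
    Integrable (fun x : ℝ => x ^ a) (gaussianReal 0 v) := by
  have h := (memLp_id_gaussianReal (μ := 0) (v := v) (a : ℝ≥0)).integrable_norm_pow'
  refine (integrable_norm_iff (by fun_prop)).1 ?_
  simpa using h

theorem hasDerivAt_gaussianPDFReal {v : ℝ≥0} (hv : v ≠ 0) (x : ℝ) :
    HasDerivAt (gaussianPDFReal 0 v) (-(x / v) * gaussianPDFReal 0 v x) x := by
  have hv' : (v : ℝ) ≠ 0 := by exact_mod_cast hv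
  have h := ((((hasDerivAt_id x).sub_const 0).pow 2).neg.div_const (2 * (v : ℝ))).exp.const_mul
    (√(2 * Real.pi * v))⁻¹
  rw [gaussianPDFReal_def]
  refine h.congr_deriv ?_
  simp only [id_eq, sub_zero, Pi.neg_apply, Pi.pow_apply]
  push_cast
  field_simp

/-- Integration by parts against the density, whose derivative is `-(x / v)` times itself. For `a =
0` the truncated exponent is harmless, being multiplied by `a`. -/
theorem integral_pow_succ_gaussianReal (v : ℝ≥0) (a : ℕ) :
    ∫ x, x ^ (a + 1) ∂(gaussianReal 0 v) = v * (a * ∫ x, x ^ (a - 1) ∂(gaussianReal 0 v)) := by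
  -- The Dirac case is needed: imaginary parts of diagonal entries have variance zero.
  by_cases hv : v = 0
  · simp [hv]
  have hv' : (v : ℝ) ≠ 0 := by exact_mod_cast hv
  have hint : ∀ k : ℕ, Integrable (fun x => x ^ k * gaussianPDFReal 0 v x) := by
    intro k
    have h := integrable_pow_gaussianReal v k
    rw [gaussianReal_of_var_ne_zero _ hv, integrable_withDensity_iff_integrable_smul'
      (measurable_gaussianPDF 0 v) (ae_of_all _ fun _ => gaussianPDF_lt_top)] at h
    simpa [mul_comm] using h
  rw [integral_gaussianReal_eq_integral_smul hv, integral_gaussianReal_eq_integral_smul hv]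
  have h := integral_mul_deriv_eq_deriv_mul_of_integrable (u := fun x : ℝ => x ^ a)
    (u' := fun x => a * x ^ (a - 1)) (v := gaussianPDFReal 0 v)
    (v' := fun x => -(x / v) * gaussianPDFReal 0 v x)
    (fun x _ => by simpa using hasDerivAt_pow a x) (fun x _ => hasDerivAt_gaussianPDFReal hv x)
    (by
      refine ((hint (a + 1)).const_mul (-(v : ℝ)⁻¹)).congr (ae_of_all _ fun x => ?_)
      simp only [Pi.mul_apply]
      ring)
    (by
      refine ((hint (a - 1)).const_mul (a : ℝ)).congr (ae_of_all _ fun x => ?_)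
      simp only [Pi.mul_apply]
      ring)
    (hint a)
  have h1 : ∫ x : ℝ, x ^ a * (-(x / v) * gaussianPDFReal 0 v x) =
      -(v : ℝ)⁻¹ * ∫ x, gaussianPDFReal 0 v x • x ^ (a + 1) := by
    rw [← integral_const_mul]
    refine integral_congr_ae (ae_of_all _ fun x => ?_)
    simp only [smul_eq_mul]
    ring
  have h2 : ∫ x : ℝ, (a * x ^ (a - 1)) * gaussianPDFReal 0 v x =
      a * ∫ x, gaussianPDFReal 0 v x • x ^ (a - 1) := by
    rw [← integral_const_mul]
    refine integral_congr_ae (ae_of_all _ fun x => ?_)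
    simp only [smul_eq_mul]
    ring
  rw [h1, h2] at h
  field_simp at h
  linarith

end Gaussian

/-! ### Expectations of polynomials in independent Gaussian variables -/

section Polynomial

open scoped NNReal ENNReal
open MvPolynomial

variable {S K : Type*} [MeasurableSpace S] {μ : Measure S} [IsProbabilityMeasure μ]
  {X : K → S → ℝ} {v : K → ℝ≥0}

theorem memLp_aeval (hX : ∀ k, HasLaw (X k) (gaussianReal 0 (v k)) μ) (P : MvPolynomial K ℂ)
    (p : ℝ≥0) : MemLp (fun x => aeval (fun k => (X k x : ℂ)) P) p μ := by
  have hXp : ∀ (k : K) (p : ℝ≥0), MemLp (fun x => (X k x : ℂ)) p μ := by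
    intro k p
    have h : MemLp (id ∘ X k) p μ := by
      refine MemLp.comp_of_map ?_ (hX k).aemeasurable
      rw [(hX k).map_eq]
      exact memLp_id_gaussianReal p
    exact h.ofReal
  induction P using MvPolynomial.induction_on generalizing p with
  | C c => simpa using memLp_const c
  | add P Q hP hQ => exact ((hP p).add (hQ p)).ae_eq (ae_of_all _ fun x => by simp)
  | mul_X P k hP =>
    -- Hölder with both exponents `2 * p`; this is why the induction runs over all finite exponents
    -- at once.
    have h := (hXp k (2 * p)).mul (hP (2 * p)) (r := p) (hpqr := ⟨by
      push_cast
      rw [ENNReal.mul_inv (by simp) (by simp), ← add_mul, ENNReal.inv_two_add_inv_two, one_mul]⟩)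
    simpa [Pi.mul_def] using h

theorem integrable_aeval (hX : ∀ k, HasLaw (X k) (gaussianReal 0 (v k)) μ)
    (P : MvPolynomial K ℂ) : Integrable (fun x => aeval (fun k => (X k x : ℂ)) P) μ :=
  memLp_one_iff_integrable.1 (by simpa using memLp_aeval hX P 1)

/-- The expectation of a polynomial in Gaussian variables, as a linear functional. -/
noncomputable def polyExp (hX : ∀ k, HasLaw (X k) (gaussianReal 0 (v k)) μ) :
    MvPolynomial K ℂ →ₗ[ℂ] ℂ where
  toFun P := ∫ x, aeval (fun k => (X k x : ℂ)) P ∂μ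
  map_add' P Q := by
    simp only [map_add]
    exact integral_add (integrable_aeval hX P) (integrable_aeval hX Q)
  map_smul' c P := by
    simp only [map_smul, smul_eq_mul, RingHom.id_apply]
    exact integral_const_mul _ _

theorem polyExp_apply (hX : ∀ k, HasLaw (X k) (gaussianReal 0 (v k)) μ) (P : MvPolynomial K ℂ) :
    polyExp hX P = ∫ x, aeval (fun k => (X k x : ℂ)) P ∂μ := rfl

theorem polyExp_one (hX : ∀ k, HasLaw (X k) (gaussianReal 0 (v k)) μ) : polyExp hX 1 = 1 := by
  simp [polyExp_apply]

/-- The monomial does not involve `X k`, so independence factors the expectation. -/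
theorem polyExp_X_pow_mul_monomial (hX : ∀ k, HasLaw (X k) (gaussianReal 0 (v k)) μ)
    (hind : iIndepFun X μ) (k : K) (a : ℕ) {s : K →₀ ℕ} (hs : s k = 0) (c : ℂ) :
    polyExp hX (MvPolynomial.X k ^ a * monomial s c) =
      ((∫ x, x ^ a ∂(gaussianReal 0 (v k)) : ℝ) : ℂ) * polyExp hX (monomial s c) := by
  classical
  have hdisj : Disjoint {k} s.support := by simp [hs]
  have hI := hind.indepFun_finset₀ {k} s.support hdisj fun i => (hX i).aemeasurable
  have h := hI.integral_fun_comp_mul_comp (𝕜 := ℂ)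
    (f := fun z => ((z ⟨k, Finset.mem_singleton_self k⟩ : ℝ) : ℂ) ^ a)
    (g := fun z => c * ∏ l : s.support, ((z l : ℝ) : ℂ) ^ s l)
    (aemeasurable_pi_lambda _ fun i => (hX i).aemeasurable)
    (aemeasurable_pi_lambda _ fun i => (hX i).aemeasurable)
    (Continuous.aestronglyMeasurable (by fun_prop))
    (Continuous.aestronglyMeasurable (by fun_prop))
  have hm : ∀ x, aeval (fun k => (X k x : ℂ)) (monomial s c) =
      c * ∏ l : s.support, ((X l x : ℝ) : ℂ) ^ s l := by
    intro x
    rw [aeval_monomial, Finsupp.prod, ← Finset.prod_coe_sort]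
    rfl
  have hk : ∫ x, ((X k x : ℝ) : ℂ) ^ a ∂μ = ((∫ x, x ^ a ∂(gaussianReal 0 (v k)) : ℝ) : ℂ) := by
    rw [← (hX k).integral_comp (by fun_prop), ← integral_complex_ofReal]
    simp
  simp only [polyExp_apply, map_mul, map_pow, aeval_X, hm]
  rw [← hk]
  exact h

/-- Gaussian integration by parts for polynomials in independent centered Gaussian variables. -/
theorem polyExp_X_mul (hX : ∀ k, HasLaw (X k) (gaussianReal 0 (v k)) μ)
    (hind : iIndepFun X μ) (k : K) (P : MvPolynomial K ℂ) :
    polyExp hX (MvPolynomial.X k * P) = v k * polyExp hX (pderiv k P) := by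
  induction P using MvPolynomial.induction_on' with
  | add P Q hP hQ => rw [mul_add, map_add, map_add, map_add, hP, hQ, mul_add]
  | monomial s c =>
    -- Isolating the power of `X k` reduces the claim to the one-variable moment recursion.
    have hs : (monomial s c : MvPolynomial K ℂ) =
        MvPolynomial.X k ^ s k * monomial (s.erase k) c := by
      rw [X_pow_eq_monomial, monomial_mul, one_mul, Finsupp.single_add_erase]
    have he : s.erase k k = 0 := Finsupp.erase_same
    have hd : pderiv k (monomial s c) =
        (s k : ℂ) • (MvPolynomial.X k ^ (s k - 1) * monomial (s.erase k) c) := by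
      rw [hs, Derivation.leibniz, pderiv_monomial, he, Derivation.leibniz_pow, pderiv_X_self]
      simp [smul_eq_mul, mul_comm, MvPolynomial.smul_eq_C_mul]
      ring
    rw [hd, hs, ← mul_assoc, ← pow_succ', polyExp_X_pow_mul_monomial hX hind k _ he, map_smul,
      polyExp_X_pow_mul_monomial hX hind k _ he, integral_pow_succ_gaussianReal]
    push_cast
    rw [smul_eq_mul]
    ring

end Polynomial

/-! ## The entries of Hermitian Gaussian random matrices as Gaussian polynomials -/

section Entries

open scoped NNReal
open MvPolynomial

/-- Indices of the real and imaginary parts of the entries on and above the diagonal. -/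
abbrev EntryIndex (U : Type*) (n : ℕ) : Type _ := U × {ij : Fin n × Fin n // ij.1 ≤ ij.2} × Bool

variable {r n : ℕ} {U : Type*}

/-- The index of the real or imaginary part of the entry `(i, j)` or `(j, i)` that lies on or above
the diagonal. -/
def entryIndex (u : U) (i j : Fin n) (c : Bool) : EntryIndex U n :=
  (u, ⟨(min i j, max i j), min_le_max⟩, c)

theorem entryIndex_comm (u : U) (i j : Fin n) (c : Bool) :
    entryIndex u i j c = entryIndex u j i c := by
  simp only [entryIndex, min_comm, max_comm]

theorem entryIndex_inj {u t : U} {i j a b : Fin n} {c c' : Bool} :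
    entryIndex u i j c = entryIndex t a b c' ↔
      u = t ∧ ((i = a ∧ j = b) ∨ (i = b ∧ j = a)) ∧ c = c' := by
  simp only [entryIndex, Prod.mk.injEq, Subtype.mk.injEq]
  refine and_congr_right fun _ => and_congr_left fun _ => ?_
  grind

/-- The factor of the imaginary part in the entry `(i, j)`. -/
noncomputable def imFactor (i j : Fin n) : ℂ :=
  if i < j then Complex.I else if j < i then -Complex.I else 0

theorem imFactor_swap (i j : Fin n) : imFactor j i = -imFactor i j := by
  unfold imFactor
  rcases lt_trichotomy i j with h | h | h
  · simp [h, h.not_gt]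
  · simp [h]
  · simp [h, h.not_gt]

theorem imFactor_mul_self {i j : Fin n} (h : i ≠ j) : imFactor i j * imFactor i j = -1 := by
  unfold imFactor
  rcases lt_or_gt_of_ne h with h | h
  · simp [h]
  · simp [h, h.not_gt]

/-- The entry `(i, j)` of the matrix `u` as a polynomial in the real and imaginary parts of the
entries on and above the diagonal. -/
noncomputable def entryPoly (u : U) (i j : Fin n) : MvPolynomial (EntryIndex U n) ℂ :=
  X (entryIndex u i j false) + C (imFactor i j) * X (entryIndex u i j true)

/-- The derivation which is `1` at the entry `(i, j)` of the matrix `u`, and `0` at the other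
entries. -/
noncomputable def entryDeriv (u : U) (i j : Fin n) :
    Derivation ℂ (MvPolynomial (EntryIndex U n) ℂ) (MvPolynomial (EntryIndex U n) ℂ) :=
  (if i = j then 1 else 1 / 2 : ℂ) •
    (pderiv (entryIndex u i j false) - imFactor i j • pderiv (entryIndex u i j true))

/-- Off the diagonal these are Wirtinger derivatives, for which an entry and its conjugate are
independent coordinates: `imFactor` squares to `-1`, giving `(1 + 1) / 2` at the entry and `(1 - 1)
/ 2` at its transpose. -/
theorem entryDeriv_entryPoly [DecidableEq U] (u : U) (a b : Fin n) (t : U) (i j : Fin n) :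
    entryDeriv u a b (entryPoly t i j) = if t = u ∧ i = a ∧ j = b then 1 else 0 := by
  classical
  have h1 : ∀ c, pderiv (entryIndex u a b c) (entryPoly t i j) =
      if t = u ∧ ((i = a ∧ j = b) ∨ (i = b ∧ j = a)) then
        (if c then C (imFactor i j) else 1 : MvPolynomial (EntryIndex U n) ℂ) else 0 := by
    intro c
    simp only [entryPoly, map_add, Derivation.leibniz, pderiv_X, pderiv_C,
      smul_eq_mul, Pi.single_apply, entryIndex_inj]
    by_cases h : t = u ∧ ((i = a ∧ j = b) ∨ (i = b ∧ j = a))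
    · cases c <;> simp [h.1, h.2]
    · have h' : ∀ c', ¬ (t = u ∧ ((i = a ∧ j = b) ∨ (i = b ∧ j = a)) ∧ c' = c) :=
        fun c' hc => h ⟨hc.1, hc.2.1⟩
      simp only [h, h', if_false]
      simp
  rw [entryDeriv, Derivation.smul_apply, Derivation.sub_apply, Derivation.smul_apply, h1, h1]
  by_cases htu : t = u
  swap
  · simp [htu]
  subst htu
  by_cases hij : i = a ∧ j = b
  · obtain ⟨rfl, rfl⟩ := hij
    by_cases h : i = j
    · subst h
      simp [imFactor]
    · simp only [h, true_or, if_true, if_false, Bool.false_eq_true, smul_eq_C_mul,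
        ← C_mul, and_self, imFactor_mul_self h]
      rw [← C_1, ← C_sub, ← C_mul]
      norm_num
  · by_cases hji : i = b ∧ j = a
    · obtain ⟨rfl, rfl⟩ := hji
      have h : j ≠ i := fun h => hij ⟨h.symm, h⟩
      simp only [h, h.symm, true_and, or_true, if_true, if_false, Bool.false_eq_true,
        smul_eq_C_mul, ← C_mul, and_self, imFactor_swap j i, mul_neg, imFactor_mul_self h]
      simp
    · simp [hij, hji]

variable {S : Type*}

/-- The real and imaginary parts of the entries. -/
def entryVar (Y : U → S → Matrix (Fin n) (Fin n) ℂ) (k : EntryIndex U n) (x : S) : ℝ :=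
  reOrIm k.2.2 (Y k.1 x k.2.1.1.1 k.2.1.1.2)

/-- The variances of the real and imaginary parts of the entries. -/
noncomputable def entryVariance (β : Fin n → Fin r) (V : U → Matrix (Fin r) (Fin r) ℝ)
    (k : EntryIndex U n) : ℝ≥0 :=
  if k.2.1.1.1 = k.2.1.1.2 then
    (if k.2.2 then 0 else (V k.1 (β k.2.1.1.1) (β k.2.1.1.2) / n).toNNReal)
  else (V k.1 (β k.2.1.1.1) (β k.2.1.1.2) / (2 * n)).toNNReal

variable {Y : U → S → Matrix (Fin n) (Fin n) ℂ}

theorem aeval_entryPoly {x : S} (u : U) (hx : (Y u x).IsHermitian) (i j : Fin n) :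
    aeval (fun k => (entryVar Y k x : ℂ)) (entryPoly u i j) = Y u x i j := by
  simp only [entryPoly, map_add, map_mul, aeval_X, entryVar, entryIndex, imFactor]
  rcases lt_trichotomy i j with h | h | h
  · simp only [min_eq_left h.le, max_eq_right h.le, reOrIm, h, if_true]
    rw [MvPolynomial.aeval_C, Algebra.algebraMap_self_apply, mul_comm, Complex.re_add_im]
  · subst h
    simp only [min_self, max_self, reOrIm, lt_irrefl, if_false, map_zero, zero_mul, add_zero]
    exact Complex.conj_eq_iff_re.1 (hx.apply i i)
  · simp only [min_eq_right h.le, max_eq_left h.le, reOrIm, h, h.not_gt, if_true, if_false]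
    rw [← hx.apply i j]
    apply Complex.ext <;> simp

variable [MeasurableSpace S] {μ : Measure S} [IsProbabilityMeasure μ]
  {N : Fin r → Finset (Fin n)} {β : Fin n → Fin r} {V : U → Matrix (Fin r) (Fin r) ℝ}

theorem hasLaw_entryVar (hβ : ∀ j q, j ∈ N q ↔ β j = q) (hY : IsIndepHGRM μ N V Y)
    (k : EntryIndex U n) :
    HasLaw (entryVar Y k) (gaussianReal 0 (entryVariance β V k)) μ := by
  obtain ⟨u, ⟨⟨i, j⟩, hij⟩, c⟩ := k
  have hu := hY.hgrm u
  unfold entryVariance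
  by_cases h : i = j
  · subst h
    cases c
    · simp only [if_true, Bool.false_eq_true, if_false]
      exact hu.law_diag (β i) i ((hβ _ _).2 rfl)
    · simp only [if_true, gaussianReal_zero_var]
      refine hasLaw_dirac_of_ae_eq (hu.hermitian.mono fun x hx => ?_)
      have := hx.apply i i
      simpa [entryVar, reOrIm] using Complex.conj_eq_iff_im.1 this
  · cases c
    · simp only [h, if_false]
      exact hu.law_re (β i) (β j) i ((hβ _ _).2 rfl) j ((hβ _ _).2 rfl) h
    · simp only [h, if_false]
      exact hu.law_im (β i) (β j) i ((hβ _ _).2 rfl) j ((hβ _ _).2 rfl) h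

/-- Off the diagonal the real and imaginary parts each contribute variance `V / (2 n)`, and the `1 /
2` in `entryDeriv` turns this into `V / n`. Multiplying by an entry yields the derivative in its
conjugate, hence the swapped indices. -/
theorem polyExp_entryPoly_mul (hβ : ∀ j q, j ∈ N q ↔ β j = q) (hV : ∀ u, (V u).IsSymm)
    (hV_pos : ∀ u p q, 0 < V u p q) (hY : IsIndepHGRM μ N V Y) (u : U) (a b : Fin n)
    (P : MvPolynomial (EntryIndex U n) ℂ) :
    polyExp (hasLaw_entryVar hβ hY) (entryPoly u a b * P) =
      (V u (β a) (β b) : ℂ) / n * polyExp (hasLaw_entryVar hβ hY) (entryDeriv u b a P) := by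
  have hst := polyExp_X_mul (hasLaw_entryVar hβ hY) hY.indep
  have hvar : ∀ c, a ≠ b → ((entryVariance β V (entryIndex u a b c) : ℝ≥0) : ℂ) =
      (V u (β a) (β b) : ℂ) / (2 * n) := by
    intro c hab
    have hne : min a b ≠ max a b := by
      rcases lt_or_gt_of_ne hab with h | h
      · rw [min_eq_left h.le, max_eq_right h.le]
        exact hab
      · rw [min_eq_right h.le, max_eq_left h.le]
        exact hab.symm
    have hVab : V u (β (min a b)) (β (max a b)) = V u (β a) (β b) := by
      rcases le_total a b with h | h
      · rw [min_eq_left h, max_eq_right h]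
      · rw [min_eq_right h, max_eq_left h]
        exact (hV u).apply _ _
    simp only [entryVariance, entryIndex, hne, if_false, hVab]
    rw [Real.coe_toNNReal _ (div_nonneg (hV_pos _ _ _).le (by positivity))]
    push_cast
    rfl
  have hX : ∀ c, polyExp (hasLaw_entryVar hβ hY) (C c * X (entryIndex u a b true) * P) =
      c * polyExp (hasLaw_entryVar hβ hY) (X (entryIndex u a b true) * P) := by
    intro c
    rw [mul_assoc, ← smul_eq_C_mul, map_smul, smul_eq_mul]
  rw [entryPoly, add_mul, map_add, hX, hst, hst, entryDeriv]
  simp only [Derivation.smul_apply, Derivation.sub_apply, map_smul, map_sub, smul_eq_mul,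
    entryIndex_comm u b a, imFactor_swap a b]
  by_cases hab : a = b
  · subst hab
    have h1 : ((entryVariance β V (entryIndex u a a false) : ℝ≥0) : ℂ) =
        (V u (β a) (β a) : ℂ) / n := by
      simp only [entryVariance, entryIndex, min_self, max_self, if_true, Bool.false_eq_true,
        if_false]
      rw [Real.coe_toNNReal _ (div_nonneg (hV_pos _ _ _).le (by positivity))]
      push_cast
      rfl
    rw [h1]
    simp [imFactor]
  · rw [hvar _ hab, hvar _ hab, if_neg (Ne.symm hab)]
    field_simp
    ring

end Entries

/-! ## Partial traces of products of symmetric blocks -/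

section Blocks

variable {r n : ℕ} {U : Type*}

theorem symBlock_eq_letterMat {N : Fin r → Finset (Fin n)} {β : Fin n → Fin r}
    (hβ : ∀ j q, j ∈ N q ↔ β j = q) (Y : U → Matrix (Fin n) (Fin n) ℂ) (p q : Fin r) (u : U) :
    symBlock N (Y u) p q = letterMat Y β (.blk p q u) := by
  ext j i
  by_cases hpq : p = q
  · subst hpq
    simp only [symBlock, blockProj, letterMat, if_true, Matrix.mul_diagonal, Matrix.diagonal_mul,
      Matrix.of_apply, hβ, SamePair, eq_comm (a := p)]
    by_cases hj : β j = p <;> by_cases hi : β i = p <;> simp [hj, hi]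
  · simp only [symBlock, blockProj, letterMat, if_neg hpq, Matrix.mul_diagonal,
      Matrix.diagonal_mul, Matrix.of_apply, Matrix.add_apply, hβ, SamePair]
    generalize β j = a
    generalize β i = b
    by_cases h1 : a = p
    · subst h1
      by_cases h2 : b = q
      · subst h2
        simp [hpq]
      · simp [h2, hpq, Ne.symm h2, Ne.symm hpq]
    · by_cases h2 : a = q
      · subst h2
        by_cases h3 : b = p
        · subst h3
          simp [h1]
        · simp [h1, h3, Ne.symm h1, Ne.symm h3]
      · simp [h1, h2, Ne.symm h1, Ne.symm h2]

theorem map_wordMat {Q Q' : Type*} [CommRing Q] [CommRing Q'] (g : Q →+* Q')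
    (y : U → Fin n → Fin n → Q) (β : Fin n → Fin r) (W : List (Letter r U)) (i j : Fin n) :
    g (wordMat y β W i j) = wordMat (fun u i j => g (y u i j)) β W i j := by
  induction W generalizing i j with
  | nil =>
    rw [wordMat_nil, wordMat_nil, Matrix.one_apply, Matrix.one_apply]
    split_ifs <;> simp
  | cons x W ih =>
    rw [wordMat_cons, wordMat_cons, Matrix.mul_apply, Matrix.mul_apply, map_sum]
    refine Finset.sum_congr rfl fun k _ => ?_
    rw [map_mul, ih]
    congr 1
    cases x with
    | blk p q u =>
      simp only [letterMat, Matrix.of_apply]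
      split_ifs <;> simp
    | proj s =>
      simp only [letterMat, Matrix.diagonal_apply]
      split_ifs <;> simp

open MvPolynomial in
theorem symBlock_prod_ae_eq {S : Type*} [MeasurableSpace S] {μ : Measure S}
    {N : Fin r → Finset (Fin n)} {β : Fin n → Fin r} (hβ : ∀ j q, j ∈ N q ↔ β j = q)
    {V : U → Matrix (Fin r) (Fin r) ℝ} {Y : U → S → Matrix (Fin n) (Fin n) ℂ}
    (hY : IsIndepHGRM μ N V Y) (L : List (Fin r × Fin r × U)) :
    ∀ᵐ x ∂μ, ∀ i j, aeval (fun k => (entryVar Y k x : ℂ))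
        (wordMat entryPoly β (L.map fun a => .blk a.1 a.2.1 a.2.2) i j) =
      (L.map fun a => symBlock N (Y a.2.2 x) a.1 a.2.1).prod i j := by
  -- Only the finitely many matrices in the word matter, so `U` may be uncountable.
  have h : ∀ᵐ x ∂μ, ∀ a ∈ L, (Y a.2.2 x).IsHermitian := by
    induction L with
    | nil => simp
    | cons a L ih =>
      filter_upwards [ih, (hY.hgrm a.2.2).hermitian] with x hx ha
      simpa using ⟨ha, by simpa using hx⟩
  filter_upwards [h] with x hx i j
  rw [← RingHom.coe_coe, map_wordMat, wordMat, List.map_map]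
  refine congrArg (fun M : List (Matrix (Fin n) (Fin n) ℂ) => M.prod i j)
    (List.map_congr_left fun a ha => ?_)
  rw [symBlock_eq_letterMat hβ fun u => Y u x]
  ext i j
  simp only [Function.comp_apply, letterMat, Matrix.of_apply, RingHom.coe_coe,
    aeval_entryPoly a.2.2 (hx a ha)]

theorem integrable_symBlock_prod {S : Type*} [MeasurableSpace S] {μ : Measure S}
    [IsProbabilityMeasure μ] {N : Fin r → Finset (Fin n)} {β : Fin n → Fin r}
    (hβ : ∀ j q, j ∈ N q ↔ β j = q) {V : U → Matrix (Fin r) (Fin r) ℝ}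
    {Y : U → S → Matrix (Fin n) (Fin n) ℂ} (hY : IsIndepHGRM μ N V Y)
    (L : List (Fin r × Fin r × U)) (i j : Fin n) :
    Integrable (fun x => (L.map fun a => symBlock N (Y a.2.2 x) a.1 a.2.1).prod i j) μ :=
  (integrable_aeval (hasLaw_entryVar hβ hY) _).congr
    ((symBlock_prod_ae_eq hβ hY L).mono fun _ hx => hx i j)

theorem blockCard_eq {N : Fin r → Finset (Fin n)} {β : Fin n → Fin r}
    (hβ : ∀ j q, j ∈ N q ↔ β j = q) (q : Fin r) : blockCard β q = ((N q).card : ℂ) := by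
  rw [blockCard]
  congr 2
  ext j
  simp [hβ]

theorem tauPartial_symBlock_prod {S : Type*} [MeasurableSpace S] {μ : Measure S}
    [IsProbabilityMeasure μ] {N : Fin r → Finset (Fin n)} {β : Fin n → Fin r}
    (hβ : ∀ j q, j ∈ N q ↔ β j = q) {V : U → Matrix (Fin r) (Fin r) ℝ}
    {Y : U → S → Matrix (Fin n) (Fin n) ℂ} (hY : IsIndepHGRM μ N V Y)
    (L : List (Fin r × Fin r × U)) (q : Fin r) :
    tauPartial μ N q (fun x => (L.map fun a => symBlock N (Y a.2.2 x) a.1 a.2.1).prod) =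
      normMoment entryPoly β (polyExp (hasLaw_entryVar hβ hY))
        [(q, L.map fun a => .blk a.1 a.2.1 a.2.2)] := by
  have hN : (Finset.univ.filter fun j => β j = q) = N q := by
    ext j
    simp [hβ]
  simp only [tauPartial, partialTr, normMoment, multiTr, List.map_cons, List.map_nil,
    List.prod_cons, List.prod_nil, mul_one, blockCard_eq hβ, blockTr, hN, polyExp_apply]
  rw [← integral_const_mul]
  refine integral_congr_ae ((symBlock_prod_ae_eq hβ hY L).mono fun x hx => ?_)
  simp only [map_sum, hx]
  rw [div_eq_inv_mul]

theorem IsIntervalPartition.exists_block {N : Fin r → Finset (Fin n)}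
    (hN : IsIntervalPartition N) : ∃ β : Fin n → Fin r, ∀ j q, j ∈ N q ↔ β j = q := by
  choose β hβ using hN.cover
  refine ⟨β, fun j q => ⟨fun h => ?_, fun h => h ▸ hβ j⟩⟩
  by_contra hne
  exact Finset.disjoint_left.1 (hN.disjoint _ _ hne) (hβ j) h

end Blocks

end BlockGauss

/-! ### The asymptotic distribution of symmetric blocks -/

theorem corollary6p2 {S : Type*} [MeasurableSpace S] (μ : Measure S) [IsProbabilityMeasure μ]
    {U : Type*} (r : ℕ)
    -- the blocks and the asymptotic dimensions
    (N : (n : ℕ) → Fin r → Finset (Fin n)) (d : Fin r → ℝ)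
    (hN : ∀ n, BlockGauss.IsIntervalPartition (N n))
    (hN_nonempty : ∀ᶠ n in atTop, ∀ q, (N n q).Nonempty)
    (hd : ∀ q, Tendsto (fun n : ℕ => ((N n q).card : ℝ) / (n : ℝ)) atTop (𝓝 (d q)))
    -- the variance matrices
    (V : U → Matrix (Fin r) (Fin r) ℝ)
    (hV_symm : ∀ u, (V u).IsSymm) (hV_pos : ∀ u p q, 0 < V u p q)
    -- the independent Hermitian Gaussian random matrices
    (Y : (n : ℕ) → U → S → Matrix (Fin n) (Fin n) ℂ)
    (hY : ∀ n, BlockGauss.IsIndepHGRM μ (N n) V (Y n))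
    (m : ℕ) (u : Fin m → U) (p q : Fin m → Fin r) (q₀ : Fin r) :
    (∀ n i j, Integrable (fun x =>
      (List.ofFn fun k => BlockGauss.symBlock (N n) (Y n (u k) x) (p k) (q k)).prod i j) μ) ∧
    Tendsto (fun n => BlockGauss.tauPartial μ (N n) q₀ (fun x =>
        (List.ofFn fun k => BlockGauss.symBlock (N n) (Y n (u k) x) (p k) (q k)).prod)) atTop
      (𝓝 (BlockGauss.vacState q₀ (List.ofFn fun k =>
        BlockGauss.symGaussian (fun t => Matrix.diagonal d * V t) (p k) (q k) (u k)).prod)) := by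
  classical
  choose β hβ using fun n => (hN n).exists_block
  set L : List (Fin r × Fin r × U) := List.ofFn fun k => (p k, q k, u k) with hL
  have hprod : ∀ n x, (List.ofFn fun k => BlockGauss.symBlock (N n) (Y n (u k) x) (p k) (q k)) =
      L.map fun a => BlockGauss.symBlock (N n) (Y n a.2.2 x) a.1 a.2.1 := by
    intro n x
    rw [hL, List.map_ofFn]
    rfl
  have hop : (List.ofFn fun k => BlockGauss.symGaussian (fun t => Matrix.diagonal d * V t) (p k) (q k) (u k))
      = L.map fun a => BlockGauss.symGaussian (fun t => Matrix.diagonal d * V t) a.1 a.2.1 a.2.2 := by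
    rw [hL, List.map_ofFn]
    rfl
  simp only [hprod, hop, BlockGauss.vacState_prod]
  refine ⟨fun n i j => BlockGauss.integrable_symBlock_prod (hβ n) (hY n) L i j, ?_⟩
  simp only [fun n => BlockGauss.tauPartial_symBlock_prod (hβ n) (hY n) L q₀]
  have hd0 : ∀ s, 0 ≤ d s := fun s =>
    ge_of_tendsto' (hd s) fun n => div_nonneg (Nat.cast_nonneg _) (Nat.cast_nonneg _)
  have hcard : ∀ᶠ n in atTop, ∀ s, BlockGauss.blockCard (β n) s ≠ 0 := hN_nonempty.mono fun n hn s => by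
    rw [BlockGauss.blockCard_eq (hβ n)]
    exact_mod_cast (Finset.card_pos.2 (hn s)).ne'
  have key := BlockGauss.tendsto_normMoment
    (fun n => BlockGauss.normMoment BlockGauss.entryPoly (β n) (BlockGauss.polyExp (BlockGauss.hasLaw_entryVar (hβ n) (hY n))))
    (BlockGauss.vacMoment fun t a b => (Real.sqrt ((Matrix.diagonal d * V t) a b) : ℂ))
    (fun t a b => (V t a b : ℂ)) (fun s => (d s : ℂ))
    (fun n s => BlockGauss.blockCard (β n) s / n) (fun n s => (BlockGauss.blockCard (β n) s)⁻¹ / n)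
    (fun s => by
      simp only [BlockGauss.blockCard_eq (hβ _)]
      refine ((Complex.continuous_ofReal.tendsto _).comp (hd s)).congr fun n => ?_
      simp)
    (fun s => by
      refine squeeze_zero_norm' (hcard.mono fun n hn => ?_) tendsto_inv_atTop_nhds_zero_nat
      -- Nonempty blocks suffice: the merging coefficient is at most `1 / n` however small the
      -- block.
      have h1 : (1 : ℝ) ≤ ‖BlockGauss.blockCard (β n) s‖ := by
        have := hn s
        rw [BlockGauss.blockCard_eq (hβ n)] at this ⊢
        rw [Complex.norm_natCast]
        exact_mod_cast Nat.one_le_iff_ne_zero.2 (by exact_mod_cast this)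
      rw [norm_div, norm_inv, Complex.norm_natCast, div_eq_mul_inv]
      exact mul_le_of_le_one_left (by positivity) (inv_le_one_of_one_le₀ h1))
    (BlockGauss.vacMoment_nil _) (BlockGauss.vacMoment_proj_cons _)
    (fun q p p' t W => by
      rw [BlockGauss.vacMoment_blk_cons]
      refine Finset.sum_congr rfl fun s _ => if_congr Iff.rfl ?_ rfl
      rw [← mul_assoc]
      congr 1
      -- The two recursions meet here: the squared Fock coefficient is `d s * V t s q`, and symmetry
      -- of `V t` turns it into the matrix coefficient with `V t q s`.
      rw [← Complex.ofReal_pow, Matrix.diagonal_mul, Real.sq_sqrt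
        (mul_nonneg (hd0 s) (hV_pos t s q).le), (hV_symm t).apply q s]
      push_cast
      ring)
    (Eventually.of_forall fun n => BlockGauss.normMoment_nil _ _ (BlockGauss.polyExp_one _))
    (hcard.mono fun n hn q L => BlockGauss.normMoment_nil_cons _ _ _ (hn q) L)
    (Eventually.of_forall fun n => BlockGauss.normMoment_proj_cons _ _ _)
    (hcard.mono fun n hn => BlockGauss.normMoment_blk_cons (β n) BlockGauss.entryDeriv BlockGauss.entryDeriv_entryPoly _ _
      (BlockGauss.polyExp_entryPoly_mul (hβ n) hV_symm hV_pos (hY n)) hn)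
    [(q₀, L.map fun a => .blk a.1 a.2.1 a.2.2)]
  simpa using key
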